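/- Let $n,d\ge 0$ be integers, $\Upsilon=[n]\times[d]\times\mathbb{Z}_+$ and $\Upsilon_m=[n]\times[d]\times[m]$, ordered lexicographically. Let $(\Omega,\mu)$ be a probability space and let $\varepsilon(u,v):\Omega\to\{-1,1\}$, for $u<v$ in $\Upsilon$, be independent random variables such that, for $u=(\alpha,i,k)$ and $v=(\beta,j,\ell)$, $$\mu\big(\varepsilon(u,v)=-1\big)=\begin{cases}1&\text{if }\alpha=\beta,\\ 1/2&\text{if }\alpha\ne\beta.\end{cases}$$ Extend them by $\varepsilon(u,v)=\varepsilon(v,u)$ and $\varepsilon(u,u)=-1$. For $\omega\in\Omega$ and $m\ge1$ let $\mathcal{A}_{\varepsilon_m}=\mathcal{A}_{\varepsilon_m(\omega)}$ be the complex unital algebra generated by elements $x_u=x_i^\alpha(k)$, $u=(\alpha,i,k)\in\Upsilon_m$, with the relations $$x_ux_v-\varepsilon(u,v)(\omega)\,x_vx_u=2\delta_{u,v}.$$ The products $x_A$ of the generators $x_u$, $u\in A$, in increasing order, for $A\subset\Upsilon_m$, form a linear basis of it; let $\tau_{\varepsilon_m}$ be the linear functional on $\mathcal{A}_{\varepsilon_m}$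 with $\tau_{\varepsilon_m}(x_A)=\delta_{A,\emptyset}$, and put $$\tilde x_i^\alpha(m)=\frac1{\sqrt m}\sum_{k=1}^m x_i^\alpha(k).$$ Let $\mathcal{C}(\mathbb{R}^d)$ be the (complex) Clifford algebra with self-adjoint generators $x_1,\dots,x_d$ satisfying $x_ix_j+x_jx_i=2\delta_{ij}$, acting on the antisymmetric Fock space, with its vacuum state. Let $(\mathcal{M},\tau)$ be the reduced free product von Neumann algebra of $n$ copies of $\mathcal{C}(\mathbb{R}^d)$ with respect to the vacuum states, let $\tau$ be the free product state (the vector state of the vacuum of the free Fock space), and let $x_i^\alpha$ be the $i$-th generator of the $\alpha$-th copy. Then for every $s\ge0$, $\underline i=(i_1,\dots,i_s)\in[d]^s$ and $\underline\alpha=(\alpha_1,\dots,\alpha_s)\in[n]^s$ we have $$\lim_{m\to\infty}\tau_{\varepsilon_m}\Big(\tilde x_{i_1}^{\alpha_1}(m)(\omega)\cdots\tilde x_{i_s}^{\alpha_s}(m)(\omega)\Big)=\tau\big(x_{i_1}^{\alpha_1}\cdots x_{i_s}^{\alpha_s}\big)\quad\text{for }\mu\text{-almost every }\omega,$$ and $$\tau\big(x_{i_1}^{\alpha_1}\cdots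 x_{i_s}^{\alpha_s}\big)=\sum_{\sigma}(-1)^{\#I(\sigma)}.$$ Here $\sigma$ runs over the partitions of $[s]$ into blocks of two elements (there are none if $s$ is odd) such that any two elements $a,b$ of a common block satisfy $i_a=i_b$ and $\alpha_a=\alpha_b$, and such that there are no two blocks $\{e,z\}$, $\{e',z'\}$ of $\sigma$ with $e<e'<z<z'$ and $\alpha_e\ne\alpha_{e'}$; and $I(\sigma)$ is the set of crossings of $\sigma$, that is, of the pairs $(\{e,z\},\{e',z'\})$ of blocks of $\sigma$ with $e<e'<z<z'$. -/

import Mathlib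

open MeasureTheory ProbabilityTheory Filter Topology
open scoped ENNReal

noncomputable section

namespace SpinCLT

/-! ### Spin algebras with prescribed commutation and anticommutation signs -/

/-- A symmetric map `I × I → {-1, 1}` which is `-1` on the diagonal. -/
structure SignFunction (I : Type*) where
  sign : I → I → ℤˣ
  symm : ∀ u v, sign u v = sign v u
  diag : ∀ u, sign u u = -1

/-- Restriction (pull-back) of a sign function along a map of index sets. -/
def SignFunction.comap {I J : Type*} (f : J → I) (ε : SignFunction I) : SignFunction J where
  sign u v := ε.sign (f u) (f v)
  symm u v := ε.symm (f u) (f v)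
  diag u := ε.diag (f u)

/-- The constant sign function `-1`: all generators anticommute. -/
def SignFunction.allNeg (I : Type*) : SignFunction I where
  sign _ _ := -1
  symm _ _ := rfl
  diag _ := rfl

/-- The relations `x_u x_v - ε(u,v) x_v x_u = 2 δ_{u,v}`. -/
inductive SpinRel {I : Type*} [DecidableEq I] (ε : SignFunction I) :
    FreeAlgebra ℂ I → FreeAlgebra ℂ I → Prop
  | rel (u v : I) : SpinRel ε
      (FreeAlgebra.ι ℂ u * FreeAlgebra.ι ℂ v
        - ((ε.sign u v : ℤ) : ℂ) • (FreeAlgebra.ι ℂ v * FreeAlgebra.ι ℂ u))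
      (if u = v then 2 else 0)

/-- The complex unital algebra generated by `x_u`, `u ∈ I`, subject to `SpinRel`. -/
abbrev SpinAlgebra {I : Type*} [DecidableEq I] (ε : SignFunction I) : Type _ :=
  RingQuot (SpinRel ε)

/-- The generator `x_u` of the spin algebra. -/
def SpinAlgebra.gen {I : Type*} [DecidableEq I] (ε : SignFunction I) (u : I) : SpinAlgebra ε :=
  RingQuot.mkAlgHom ℂ (SpinRel ε) (FreeAlgebra.ι ℂ u)

section Representation

variable {I : Type*} [LinearOrder I]

/-- The sign `∏_{a ∈ A, a < v} ε(v,a)` created when `x_v` is moved to its place in the increasing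
product `x_A`, so that `x_v x_A = moveSign ε v A • x_{A ∆ {v}}`. -/
def moveSign (ε : SignFunction I) (v : I) (A : Finset I) : ℤˣ :=
  ∏ a ∈ A with a < v, ε.sign v a

/-- The matrix of left multiplication by `x_v` in the basis of increasing products `x_A`.
When all the signs are `-1` this is also the matrix of the operator `c_v + c_v^*`
(annihilation plus creation) in the basis `e_A = e_{a₁} ⊗ ⋯ ⊗ e_{aᵣ}`, `a₁ < ⋯ < aᵣ`, of the
antisymmetric Fock space. -/
def spinMatrix (ε : SignFunction I) (v : I) : Matrix (Finset I) (Finset I) ℂ :=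
  Matrix.of fun B A => if B = symmDiff A {v} then ((moveSign ε v A : ℤ) : ℂ) else 0

theorem moveSign_symmDiff (ε : SignFunction I) (u v : I) (A : Finset I) :
    moveSign ε u (symmDiff A {v}) =
      moveSign ε u A * (if v < u then ε.sign u v else 1) := by
  unfold moveSign
  by_cases hv : v ∈ A
  · have h1 : symmDiff A {v} = A.erase v := by
      ext x; simp only [Finset.mem_symmDiff, Finset.mem_singleton, Finset.mem_erase]; grind
    rw [h1]
    by_cases hlt : v < u
    · have : v ∈ A.filter (· < u) := by simp [hv, hlt]
      rw [if_pos hlt, Finset.filter_erase, ← Finset.prod_erase_mul _ _ this, mul_assoc,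
        Int.units_mul_self, mul_one]
    · have : v ∉ A.filter (· < u) := by simp [hlt]
      rw [if_neg hlt, Finset.filter_erase, Finset.erase_eq_of_notMem this, mul_one]
  · have h1 : symmDiff A {v} = insert v A := by
      ext x; simp only [Finset.mem_symmDiff, Finset.mem_singleton, Finset.mem_insert]; grind
    rw [h1, Finset.filter_insert]
    by_cases hlt : v < u
    · rw [if_pos hlt, if_pos hlt, Finset.prod_insert (by simp [hv]), mul_comm]
    · rw [if_neg hlt, if_neg hlt, mul_one]

theorem spinMatrix_mul [Fintype I] (ε : SignFunction I) (u v : I) (C A : Finset I) :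
    (spinMatrix ε u * spinMatrix ε v) C A =
      if C = symmDiff (symmDiff A {v}) {u} then
        (((moveSign ε u A * moveSign ε v A * (if v < u then ε.sign u v else 1) : ℤˣ) : ℤ) : ℂ)
      else 0 := by
  rw [Matrix.mul_apply, Finset.sum_eq_single (symmDiff A {v})]
  · simp only [spinMatrix, Matrix.of_apply, if_true, moveSign_symmDiff]
    split_ifs <;> push_cast <;> ring
  · intro B _ hB
    simp [spinMatrix, hB]
  · simp

theorem spinMatrix_rel [Fintype I] (ε : SignFunction I) (u v : I) :
    spinMatrix ε u * spinMatrix ε v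
      - ((ε.sign u v : ℤ) : ℂ) • (spinMatrix ε v * spinMatrix ε u) =
      (if u = v then 2 else 0 : Matrix (Finset I) (Finset I) ℂ) := by
  ext C A
  rw [Matrix.sub_apply, Matrix.smul_apply, spinMatrix_mul, spinMatrix_mul]
  have hs : symmDiff (symmDiff A {u}) {v} = symmDiff (symmDiff A {v}) {u} :=
    symmDiff_right_comm A {u} {v}
  rw [hs]
  by_cases huv : u = v
  · subst huv
    have h2 : (2 : Matrix (Finset I) (Finset I) ℂ) C A = if C = A then 2 else 0 := by
      rw [Matrix.ofNat_apply]
      split_ifs <;> simp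
    rw [if_pos rfl, h2, symmDiff_symmDiff_cancel_right]
    simp only [lt_irrefl, if_false, mul_one, Int.units_mul_self, ε.diag]
    split_ifs <;> norm_num
  · rw [if_neg huv, Matrix.zero_apply]
    split_ifs with hC h1 h2 h3
    · exact absurd h2 (not_lt.mpr h1.le)
    · push_cast; simp; ring
    · rw [ε.symm v u]
      have := Int.units_mul_self (ε.sign u v)
      have h' : ((ε.sign u v : ℤ) : ℂ) * ((ε.sign u v : ℤ) : ℂ) = 1 := by
        have h'' : ((ε.sign u v : ℤ)) * (ε.sign u v : ℤ) = 1 := by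
          rw [← Units.val_mul, this, Units.val_one]
        exact_mod_cast h''
      push_cast
      simp only [smul_eq_mul, mul_one]
      linear_combination (-((moveSign ε u A : ℤ) : ℂ) * ((moveSign ε v A : ℤ) : ℂ)) * h'
    · exact absurd (lt_of_le_of_ne (not_lt.mp h1) huv) (by assumption)
    · simp

/-- The left regular representation of the spin algebra, as matrices in the basis `(x_A)`
of increasing products. -/
def leftRegular [Fintype I] (ε : SignFunction I) :
    SpinAlgebra ε →ₐ[ℂ] Matrix (Finset I) (Finset I) ℂ :=
  RingQuot.liftAlgHom ℂ ⟨FreeAlgebra.lift ℂ (spinMatrix ε), by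
    rintro _ _ ⟨u, v⟩
    have h := spinMatrix_rel ε u v
    simp only [map_sub, map_mul, map_smul, FreeAlgebra.lift_ι_apply, h]
    split_ifs <;> simp [map_ofNat]⟩

/-- The tracial state `τ_ε(a) = ⟨1, a · 1⟩` of the spin algebra, that is, the coefficient of
`x_∅ = 1` in the expansion of `a` in the basis `(x_A)`. -/
def spinTrace [Fintype I] (ε : SignFunction I) : SpinAlgebra ε →ₗ[ℂ] ℂ :=
  (Matrix.entryLinearMap ℂ ℂ (∅ : Finset I) (∅ : Finset I)).comp (leftRegular ε).toLinearMap

/-- The increasing product `x_A`. -/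
def SpinAlgebra.monomial (ε : SignFunction I) (A : Finset I) : SpinAlgebra ε :=
  ((A.sort (· ≤ ·)).map (SpinAlgebra.gen ε)).prod

/-- `spinTrace` is the functional with `τ_ε(x_A) = δ_{A,∅}`. -/
theorem spinTrace_monomial [Fintype I] (ε : SignFunction I) (A : Finset I) :
    spinTrace ε (SpinAlgebra.monomial ε A) = if A = ∅ then 1 else 0 := by
  have hgen : ∀ v, leftRegular ε (SpinAlgebra.gen ε v) = spinMatrix ε v := by
    intro v
    simp [leftRegular, SpinAlgebra.gen]
  have key : ∀ l : List I, l.Pairwise (· < ·) → ∀ B : Finset I,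
      leftRegular ε ((l.map (SpinAlgebra.gen ε)).prod) B ∅ = if B = l.toFinset then 1 else 0 := by
    intro l
    induction l with
    | nil =>
      intro _ B
      simp only [List.map_nil, List.prod_nil, map_one, Matrix.one_apply, List.toFinset_nil]
      congr
    | cons v l ih =>
      intro hl B
      rw [List.pairwise_cons] at hl
      rw [List.map_cons, List.prod_cons, map_mul, hgen, Matrix.mul_apply,
        Finset.sum_eq_single l.toFinset]
      · rw [ih hl.2, if_pos rfl, mul_one]
        have hv : symmDiff l.toFinset {v} = (v :: l).toFinset := by
          have : v ∉ l := fun h => lt_irrefl _ (hl.1 v h)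
          ext x
          simp only [Finset.mem_symmDiff, Finset.mem_singleton, List.mem_toFinset,
            List.mem_cons]
          grind
        have hm : moveSign ε v l.toFinset = 1 := by
          unfold moveSign
          rw [Finset.filter_false_of_mem, Finset.prod_empty]
          intro a ha
          exact not_lt.mpr (hl.1 a (List.mem_toFinset.mp ha)).le
        simp [spinMatrix, hv, hm]
      · intro C _ hC
        rw [ih hl.2, if_neg hC, mul_zero]
      · simp
  have := key (A.sort (· ≤ ·)) (Finset.sortedLT_sort A).pairwise ∅
  simp only [Finset.sort_toFinset] at this
  simp only [spinTrace, SpinAlgebra.monomial, LinearMap.comp_apply, AlgHom.toLinearMap_apply,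
    Matrix.entryLinearMap_apply]
  rw [this]
  simp [eq_comm]

end Representation

/-! ### The Clifford algebra and its vacuum representation -/

/-- The Clifford algebra `C(ℝ^d)` with complex coefficients. -/
abbrev Clifford (d : ℕ) : Type :=
  CliffordAlgebra (QuadraticMap.weightedSumSquares ℂ (fun _ : Fin d => (1 : ℂ)))

/-- The generator `x_i` of the Clifford algebra. -/
def Clifford.gen {d : ℕ} (i : Fin d) : Clifford d :=
  CliffordAlgebra.ι _ (Pi.single i 1)

/-- The action of `C(ℝ^d)` on the antisymmetric Fock space, equivalently on `L₂(C(ℝ^d), τ)` by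
left multiplication, as matrices in the orthonormal basis `(x_A Ω)`, `A ⊆ [d]`. The vacuum `Ω` is
the basis vector of `A = ∅`. -/
def cliffordRep (d : ℕ) : Clifford d →ₐ[ℂ] Matrix (Finset (Fin d)) (Finset (Fin d)) ℂ :=
  CliffordAlgebra.lift _
    ⟨∑ i : Fin d, (LinearMap.proj i : (Fin d → ℂ) →ₗ[ℂ] ℂ).smulRight
        (spinMatrix (SignFunction.allNeg (Fin d)) i), by
      intro v
      set X := spinMatrix (SignFunction.allNeg (Fin d)) with hX
      have hrel : ∀ i j, X i * X j + X j * X i =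
          (if i = j then 2 else 0 : Matrix (Finset (Fin d)) (Finset (Fin d)) ℂ) := by
        intro i j
        have := spinMatrix_rel (SignFunction.allNeg (Fin d)) i j
        rw [← hX] at this
        have hs : (SignFunction.allNeg (Fin d)).sign i j = -1 := rfl
        simpa [hs] using this
      have e1 : (∑ i : Fin d, (LinearMap.proj i : (Fin d → ℂ) →ₗ[ℂ] ℂ).smulRight (X i)) v
          = ∑ i, v i • X i := by simp [LinearMap.sum_apply]
      rw [e1]
      have e2 : (∑ i, v i • X i) * (∑ i, v i • X i)
          = ∑ i, ∑ j, (v i * v j) • (X i * X j) := by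
        rw [Finset.sum_mul_sum]
        refine Finset.sum_congr rfl fun i _ => Finset.sum_congr rfl fun j _ => ?_
        rw [smul_mul_smul_comm]
      have e3 : (∑ i, v i • X i) * (∑ i, v i • X i)
          = ∑ i, ∑ j, (v i * v j) • (X j * X i) := by
        rw [e2, Finset.sum_comm]
        refine Finset.sum_congr rfl fun i _ => Finset.sum_congr rfl fun j _ => ?_
        rw [mul_comm]
      have e4 : (2 : ℂ) • ((∑ i, v i • X i) * (∑ i, v i • X i))
          = (2 : ℂ) • algebraMap ℂ (Matrix (Finset (Fin d)) (Finset (Fin d)) ℂ)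
            (QuadraticMap.weightedSumSquares ℂ (fun _ : Fin d => (1 : ℂ)) v) := by
        rw [two_smul]
        nth_rewrite 1 [e2]
        rw [e3, ← Finset.sum_add_distrib]
        simp_rw [← Finset.sum_add_distrib, ← smul_add, hrel]
        simp only [smul_ite, smul_zero, Finset.sum_ite_eq, Finset.mem_univ, if_true,
          QuadraticMap.weightedSumSquares_apply, one_smul, map_sum, Finset.smul_sum]
        refine Finset.sum_congr rfl fun i _ => ?_
        rw [Algebra.algebraMap_eq_smul_one, smul_comm]
        congr 1
        rw [two_smul, one_add_one_eq_two]
      exact smul_right_injective _ (two_ne_zero (α := ℂ)) e4⟩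

/-! ### The free Fock space and the reduced free product -/

/-- Reduced words `A₁^{α₁} ⋯ A_ℓ^{α_ℓ}`: the letters are pairs `(α, A)` with `α ∈ [n]` and
`∅ ≠ A ⊆ [d]`, and neighbouring letters have different `α`. -/
@[ext]
structure ReducedWord (n d : ℕ) where
  letters : List (Fin n × Finset (Fin d))
  nonempty : ∀ x ∈ letters, x.2.Nonempty
  chain : letters.IsChain (fun x y => x.1 ≠ y.1)

namespace ReducedWord

variable {n d : ℕ}

instance : DecidableEq (ReducedWord n d) := fun w w' =>
  decidable_of_iff (w.letters = w'.letters) ReducedWord.ext_iff.symm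

/-- The empty word. -/
def nil : ReducedWord n d := ⟨[], by simp, by simp⟩

/-- The `α`-part at the left end of a list of letters: `A` if the list starts with the letter
`(α, A)`, and `∅` (the index of the vacuum of the copy `α`) if it does not start with a letter of
copy `α`. -/
def headPart (α : Fin n) : List (Fin n × Finset (Fin d)) → Finset (Fin d)
  | [] => ∅
  | x :: _ => if x.1 = α then x.2 else ∅

/-- The list of letters without its left `α`-part. -/
def tailPart (α : Fin n) : List (Fin n × Finset (Fin d)) → List (Fin n × Finset (Fin d))
  | [] => []
  | x :: l => if x.1 = α then l else x :: l

/-- The left `α`-part of a reduced word. -/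
def head (α : Fin n) (w : ReducedWord n d) : Finset (Fin d) := headPart α w.letters

/-- The reduced word without its left `α`-part. -/
def tail (α : Fin n) (w : ReducedWord n d) : ReducedWord n d where
  letters := tailPart α w.letters
  nonempty := by
    intro x hx
    refine w.nonempty x ?_
    revert hx
    cases w.letters with
    | nil => exact id
    | cons y l =>
      intro hx
      simp only [tailPart] at hx
      split_ifs at hx
      · exact List.mem_cons_of_mem _ hx
      · exact hx
  chain := by
    have h := w.chain
    revert h
    cases w.letters with
    | nil => exact id
    | cons y l =>
      intro h
      simp only [tailPart]
      split_ifs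
      · exact h.tail
      · exact h

/-- The word does not start with a letter of the copy `α`. -/
def Avoids (α : Fin n) (w : ReducedWord n d) : Prop := ∀ x ∈ w.letters.head?, x.1 ≠ α

theorem tail_avoids (α : Fin n) (w : ReducedWord n d) : (w.tail α).Avoids α := by
  rcases w with ⟨l, h1, h2⟩
  rcases l with _ | ⟨x, l⟩
  · simp [tail, tailPart, Avoids]
  · by_cases hx : x.1 = α
    · rcases l with _ | ⟨y, l⟩
      · simp [tail, tailPart, Avoids, hx]
      · rw [List.isChain_cons_cons] at h2
        simpa [tail, tailPart, Avoids, hx] using fun h => h2.1 (hx.trans h.symm)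
    · simp [tail, tailPart, Avoids, hx]

/-- Put the `α`-part `A` in front of a word that does not start with a letter of copy `α`; the
vacuum `∅` is not written. -/
def cons (α : Fin n) (A : Finset (Fin d)) (w : ReducedWord n d) (hw : w.Avoids α) :
    ReducedWord n d where
  letters := if A.Nonempty then (α, A) :: w.letters else w.letters
  nonempty := by
    intro x hx
    split_ifs at hx with hA
    · rcases List.mem_cons.mp hx with rfl | hx
      · exact hA
      · exact w.nonempty x hx
    · exact w.nonempty x hx
  chain := by
    split_ifs
    · rw [List.isChain_cons]
      exact ⟨fun y hy => (hw y hy).symm, w.chain⟩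
    · exact w.chain

theorem cons_head_tail (α : Fin n) (w : ReducedWord n d) :
    cons α (w.head α) (w.tail α) (w.tail_avoids α) = w := by
  rcases w with ⟨l, h1, h2⟩
  apply ReducedWord.ext
  rcases l with _ | ⟨x, l⟩
  · simp [cons, head, tail, headPart, tailPart]
  · by_cases hx : x.1 = α
    · subst hx
      have := h1 x (by simp)
      simp [cons, head, tail, headPart, tailPart, this]
    · simp [cons, head, tail, headPart, tailPart, hx]

theorem head_cons (α : Fin n) (A : Finset (Fin d)) (w : ReducedWord n d) (hw : w.Avoids α) :
    (cons α A w hw).head α = A := by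
  by_cases hA : A.Nonempty
  · simp [cons, head, headPart, hA]
  · rw [Finset.not_nonempty_iff_eq_empty] at hA
    subst hA
    rcases w with ⟨_ | ⟨x, l⟩, h1, h2⟩
    · simp [cons, head, headPart]
    · have : x.1 ≠ α := hw x (by simp)
      simp [cons, head, headPart, this]

theorem tail_cons (α : Fin n) (A : Finset (Fin d)) (w : ReducedWord n d) (hw : w.Avoids α) :
    (cons α A w hw).tail α = w := by
  apply ReducedWord.ext
  by_cases hA : A.Nonempty
  · simp [cons, tail, tailPart, hA]
  · rcases w with ⟨_ | ⟨x, l⟩, h1, h2⟩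
    · simp [cons, tail, tailPart, hA]
    · have : x.1 ≠ α := hw x (by simp)
      simp [cons, tail, tailPart, hA, this]

/-- Replace the left `α`-part of a word by `B`. -/
def replaceHead (α : Fin n) (B : Finset (Fin d)) (w : ReducedWord n d) : ReducedWord n d :=
  cons α B (w.tail α) (w.tail_avoids α)

theorem eq_of_replaceHead_eq {α : Fin n} {A B : Finset (Fin d)} {w w' : ReducedWord n d}
    (hw : w.head α = A) (hw' : w'.head α = A)
    (h : w.replaceHead α B = w'.replaceHead α B) : w = w' := by
  have ht : w.tail α = w'.tail α := by
    have := congrArg (tail α) h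
    simpa [replaceHead, tail_cons] using this
  rw [← cons_head_tail α w, ← cons_head_tail α w']
  simp only [hw, hw', ht]

end ReducedWord

/-- The free Fock space `ℂΩ ⊕ ⨁_{α₁ ≠ ⋯ ≠ α_ℓ} H°_{α₁} ⊗ ⋯ ⊗ H°_{α_ℓ}`, where each
`H_α = L₂(C(ℝ^d), τ)` has the orthonormal basis `(x_A)_{A ⊆ [d]}` and `H°_α` is the span of the
`x_A` with `A ≠ ∅`. The elementary tensors `x_{A₁} ⊗ ⋯ ⊗ x_{A_ℓ}` form an orthonormal basis, which
is indexed by the reduced words. -/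
abbrev FreeFock (n d : ℕ) : Type := lp (fun _ : ReducedWord n d => ℂ) 2

/-- The vacuum vector: the basis vector of the empty word. -/
def vacuum (n d : ℕ) : FreeFock n d := lp.single 2 ReducedWord.nil 1

section FreeAction

variable {n d : ℕ}

theorem sum_unitAction_le (α : Fin n) (B C : Finset (Fin d)) (f : FreeFock n d)
    (s : Finset (ReducedWord n d)) :
    ∑ w ∈ s, ‖(if w.head α = B then f (w.replaceHead α C) else 0 : ℂ)‖ ^ (2 : ℝ≥0∞).toReal
      ≤ ‖f‖ ^ (2 : ℝ≥0∞).toReal := by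
  have h2 : (2 : ℝ≥0∞).toReal = 2 := by simp
  have hpos : 0 < (2 : ℝ≥0∞).toReal := by simp
  calc _ = ∑ w ∈ s.filter (fun w => w.head α = B),
        ‖f (w.replaceHead α C)‖ ^ (2 : ℝ≥0∞).toReal := by
        rw [Finset.sum_filter]
        refine Finset.sum_congr rfl fun w _ => ?_
        split_ifs
        · rfl
        · rw [norm_zero, h2]; norm_num
    _ = ∑ v ∈ (s.filter (fun w => w.head α = B)).image (ReducedWord.replaceHead α C),
        ‖f v‖ ^ (2 : ℝ≥0∞).toReal := by
        rw [Finset.sum_image]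
        intro w hw w' hw' h
        simp only [Finset.coe_filter, Set.mem_ofPred_eq] at hw hw'
        exact ReducedWord.eq_of_replaceHead_eq hw.2 hw'.2 h
    _ ≤ _ := lp.sum_rpow_le_norm_rpow hpos f _

/-- The action on the free Fock space of the matrix unit `E_{B,C}` (`x_C ↦ x_B`) of `B(H_α)`:
it sends `x_C ⊗ h` to `x_B ⊗ h` and kills `x_A ⊗ h` for `A ≠ C`, for every tensor `h` that does not
start in `H°_α`, where `x_∅ ⊗ h` is read as `h`. -/
def unitAction (α : Fin n) (B C : Finset (Fin d)) : FreeFock n d →L[ℂ] FreeFock n d :=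
  LinearMap.mkContinuous
    { toFun := fun f =>
        ⟨fun w => if w.head α = B then f (w.replaceHead α C) else 0,
          memℓp_gen' (C := ‖f‖ ^ (2 : ℝ≥0∞).toReal) (sum_unitAction_le α B C f)⟩
      map_add' := by
        intro f g
        ext w
        simp only [lp.coeFn_add, Pi.add_apply]
        split_ifs <;> simp
      map_smul' := by
        intro c f
        ext w
        simp only [lp.coeFn_smul, Pi.smul_apply, RingHom.id_apply]
        split_ifs <;> simp }
    1 (by
      intro f
      rw [one_mul]
      exact lp.norm_le_of_forall_sum_le (by simp) (norm_nonneg _) (sum_unitAction_le α B C f))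

/-- The action `ω_α` on the free Fock space of an operator on `H_α`, given by its matrix in the
basis `(x_A)`. For a word `h` that does not start in `H°_α`, it sends `x_C ⊗ h` to
`∑_B T_{B,C} x_B ⊗ h`, where `x_∅ ⊗ h` is read as `h`. -/
def freeAction (α : Fin n) (T : Matrix (Finset (Fin d)) (Finset (Fin d)) ℂ) :
    FreeFock n d →L[ℂ] FreeFock n d :=
  ∑ B, ∑ C, T B C • unitAction α B C

/-- The formula for `ω_α` on basis vectors. -/
theorem freeAction_single (α : Fin n) (T : Matrix (Finset (Fin d)) (Finset (Fin d)) ℂ)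
    (C : Finset (Fin d)) (h : ReducedWord n d) (hh : h.Avoids α) :
    freeAction α T (lp.single 2 (ReducedWord.cons α C h hh) 1) =
      ∑ B, T B C • (lp.single 2 (ReducedWord.cons α B h hh) 1 : FreeFock n d) := by
  have key : ∀ B D : Finset (Fin d),
      unitAction α B D (lp.single 2 (ReducedWord.cons α C h hh) 1 : FreeFock n d) =
        if D = C then (lp.single 2 (ReducedWord.cons α B h hh) 1 : FreeFock n d) else 0 := by
    intro B D
    ext w
    have hL : (unitAction α B D (lp.single 2 (ReducedWord.cons α C h hh) 1 : FreeFock n d)) w =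
        if w.head α = B then
          (lp.single 2 (ReducedWord.cons α C h hh) 1 : FreeFock n d) (w.replaceHead α D)
        else 0 := rfl
    rw [hL, lp.single_apply, Pi.single_apply]
    have hiff : w.replaceHead α D = ReducedWord.cons α C h hh ↔ D = C ∧ w.tail α = h := by
      constructor
      · intro e
        have e1 := congrArg (ReducedWord.head α) e
        have e2 := congrArg (ReducedWord.tail α) e
        simp only [ReducedWord.replaceHead, ReducedWord.head_cons, ReducedWord.tail_cons] at e1 e2
        exact ⟨e1, e2⟩
      · rintro ⟨rfl, rfl⟩
        rfl
    have hiff2 : w = ReducedWord.cons α B h hh ↔ w.head α = B ∧ w.tail α = h := by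
      constructor
      · rintro rfl
        exact ⟨ReducedWord.head_cons .., ReducedWord.tail_cons ..⟩
      · rintro ⟨rfl, rfl⟩
        exact (ReducedWord.cons_head_tail α w).symm
    by_cases hD : D = C
    · subst hD
      rw [if_pos rfl, lp.single_apply, Pi.single_apply]
      simp only [hiff, hiff2, true_and]
      by_cases h1 : w.head α = B <;> by_cases h2 : w.tail α = h <;> simp [h1, h2]
    · simp [hiff, hD]
  simp only [freeAction, sum_apply, smul_apply, key,
    smul_ite, smul_zero, Finset.sum_ite_eq', Finset.mem_univ, if_true]

end FreeAction

/-- The copy of `C(ℝ^d)` in position `α` acting on the free Fock space. -/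
def cliffordAction {n d : ℕ} (α : Fin n) (a : Clifford d) : FreeFock n d →L[ℂ] FreeFock n d :=
  freeAction α (cliffordRep d a)

/-- The von Neumann algebra generated by a set of operators: the bicommutant of the set and its
adjoints. -/
def vonNeumannGenerated {H : Type*} [NormedAddCommGroup H] [InnerProductSpace ℂ H]
    [CompleteSpace H] (S : Set (H →L[ℂ] H)) : VonNeumannAlgebra H where
  toStarSubalgebra := StarSubalgebra.centralizer ℂ (StarSubalgebra.centralizer ℂ S : Set (H →L[ℂ] H))
  centralizer_centralizer' := by
    change Set.centralizer (Set.centralizer (Set.centralizer _)) = Set.centralizer _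
    exact Set.centralizer_centralizer_centralizer _

theorem subset_vonNeumannGenerated {H : Type*} [NormedAddCommGroup H] [InnerProductSpace ℂ H]
    [CompleteSpace H] (S : Set (H →L[ℂ] H)) {x : H →L[ℂ] H} (hx : x ∈ S) :
    x ∈ vonNeumannGenerated S := by
  change x ∈ StarSubalgebra.centralizer ℂ (StarSubalgebra.centralizer ℂ S : Set (H →L[ℂ] H))
  rw [StarSubalgebra.mem_centralizer_iff]
  intro g hg
  have hg' : star g ∈ StarSubalgebra.centralizer ℂ S := star_mem hg
  rw [SetLike.mem_coe, StarSubalgebra.mem_centralizer_iff] at hg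
  rw [StarSubalgebra.mem_centralizer_iff] at hg'
  exact ⟨(hg x hx).1.symm, (hg' x hx).1.symm⟩

/-- The reduced free product von Neumann algebra of `n` copies of `C(ℝ^d)`, with respect to the
vacuum states. -/
def freeProduct (n d : ℕ) : VonNeumannAlgebra (FreeFock n d) :=
  vonNeumannGenerated (⋃ α : Fin n, Set.range (cliffordAction (n := n) (d := d) α))

/-- The generator `x_i^α` of the copy `α` of `C(ℝ^d)` in the free product. -/
def freeGen {n d : ℕ} (α : Fin n) (i : Fin d) : freeProduct n d :=
  ⟨cliffordAction α (Clifford.gen i),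
    subset_vonNeumannGenerated _ (Set.mem_iUnion.mpr ⟨α, Set.mem_range_self _⟩)⟩

/-- The free product state `τ(T) = ⟨T Ω, Ω⟩`. (Mathlib's inner product is linear in its second
argument.) -/
def freeState {n d : ℕ} (T : freeProduct n d) : ℂ :=
  inner ℂ (vacuum n d) ((T : FreeFock n d →L[ℂ] FreeFock n d) (vacuum n d))

/-! ### The random matrix model -/

/-- The index set `Υ = [n] × [d] × ℕ` with the lexicographical order. -/
abbrev Idx (n d : ℕ) : Type := Fin n ×ₗ Fin d ×ₗ ℕ

/-- The index set `Υ_m = [n] × [d] × [m]` with the lexicographical order. -/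
abbrev IdxTrunc (n d m : ℕ) : Type := Fin n ×ₗ Fin d ×ₗ Fin m

/-- The triple `(α, i, k)`. -/
def mkIdx {n d m : ℕ} (α : Fin n) (i : Fin d) (k : Fin m) : IdxTrunc n d m :=
  toLex (α, toLex (i, k))

/-- The first component `α` of `(α, i, k)`. -/
def Idx.copy {n d : ℕ} (u : Idx n d) : Fin n := (ofLex u).1

/-- The inclusion `Υ_m ⊆ Υ`. -/
def IdxTrunc.incl {n d m : ℕ} (u : IdxTrunc n d m) : Idx n d :=
  toLex ((ofLex u).1, toLex ((ofLex (ofLex u).2).1, ((ofLex (ofLex u).2).2 : ℕ)))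

/-- The truncation `ε_m` of a sign function to `Υ_m`. -/
def truncate {n d : ℕ} (ε : SignFunction (Idx n d)) (m : ℕ) : SignFunction (IdxTrunc n d m) :=
  ε.comap IdxTrunc.incl

/-- The normalized sum `x̃_i^α(m) = m^{-1/2} ∑_k x_i^α(k)`. -/
def normalizedSum {n d : ℕ} (ε : SignFunction (Idx n d)) (m : ℕ) (α : Fin n) (i : Fin d) :
    SpinAlgebra (truncate ε m) :=
  (((Real.sqrt m)⁻¹ : ℝ) : ℂ) • ∑ k : Fin m, SpinAlgebra.gen (truncate ε m) (mkIdx α i k)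

/-! ### Pair partitions and crossings -/

/-- The partition of `[s]` whose blocks are the level sets of the tuple `t`. -/
def tuplePartition {s : ℕ} {N : Type*} [DecidableEq N] (t : Fin s → N) :
    Finpartition (Finset.univ : Finset (Fin s)) :=
  letI : DecidableRel (Setoid.ker t) := fun a b => inferInstanceAs (Decidable (t a = t b))
  Finpartition.ofSetoid (Setoid.ker t)

/-- All blocks have two elements. -/
def IsPairPartition {s : ℕ} (σ : Finpartition (Finset.univ : Finset (Fin s))) : Prop :=
  ∀ V ∈ σ.parts, V.card = 2

open Classical in
/-- The crossings of `σ`: the pairs of blocks `V = {e, z}`, `V' = {e', z'}` with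
`e < e' < z < z'`. -/
def crossings {s : ℕ} (σ : Finpartition (Finset.univ : Finset (Fin s))) :
    Finset (Finset (Fin s) × Finset (Fin s)) :=
  (σ.parts ×ˢ σ.parts).filter fun p => ∃ e e' z z' : Fin s,
    e < e' ∧ e' < z ∧ z < z' ∧ p.1 = {e, z} ∧ p.2 = {e', z'}

open Classical in
/-- The crossings `{e, z}`, `{e', z'}` of `σ` with `α_e ≠ α_{e'}`. -/
def mixedCrossings {s : ℕ} {N : Type*} (α : Fin s → N)
    (σ : Finpartition (Finset.univ : Finset (Fin s))) :
    Finset (Finset (Fin s) × Finset (Fin s)) :=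
  (σ.parts ×ˢ σ.parts).filter fun p => ∃ e e' z z' : Fin s,
    e < e' ∧ e' < z ∧ z < z' ∧ p.1 = {e, z} ∧ p.2 = {e', z'} ∧ α e ≠ α e'

open Classical in
/-- The pair partitions `σ` with `σ ≤ σ(i)`, `σ ≤ σ(α)` and no crossing between pairs of different
copies. -/
def admissiblePartitions {s n d : ℕ} (α : Fin s → Fin n) (i : Fin s → Fin d) :
    Finset (Finpartition (Finset.univ : Finset (Fin s))) :=
  Finset.univ.filter fun σ => IsPairPartition σ ∧ σ ≤ tuplePartition i ∧ σ ≤ tuplePartition α ∧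
    mixedCrossings α σ = ∅

end SpinCLT

end

open SpinCLT

noncomputable section

namespace SpinCLT

/-! ### Pairings as involutions and their crossings -/

section Pairings

variable {P I : Type*} [LinearOrder P] [Fintype P]

/-! Both moments are instances of one combinatorial formula. Consider a functional on words in an
ordered alphabet divided into copies. Suppose that it is 1 on the empty word, cancels neighbouring
equal letters, gains a sign q(u,v) when distinct neighbours of one copy are exchanged, and vanishes
on nonempty words in which neighbours of one copy increase strictly. Sorting shows that these rules
determine it. If q is symmetric, squares to 1 within a copy, equals -1 on the diagonal and 0 across
copies, then the sum over pairings of equal letters of the product of q over the crossings obeys the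
same rules, so the two agree (`eq_pairingSum`). The spin trace is the case of a single copy with q =
ε. The free product state is the case q = -1 within a copy and q = 0 across copies, which forbids
mixed crossings and leaves the signed count of admissible pair partitions
(`sum_admissiblePartitions`).

Expanding the normalized sums gives an identity that is exact for every m, with no generic-label
approximation (`spinTrace_normalizedSum_prod_eq`): the moment is a sum over the pairings f of [s]
compatible with the copies and the generator indices. The term of f is the average, over all
labellings of its s/2 left endpoints by [m], of the product of the signs ε over the crossings of f.
It remains to find the limit of each average.

If all crossings of f lie within copies, every product is almost surely (-1) to the number of
crossings. If some crossing c is mixed, the average tends to 0. Labellings with a repeated label are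
a vanishing proportion. For injective κ the fair sign at c occurs once in the product of κ, so by
independence the products of κ and κ' are uncorrelated unless κ' puts the same two labels on one of
its crossings. This happens for a proportion O(1/m²) of the pairs, hence the second moment is
O(1/m²). That is summable, which yields almost sure convergence. -/

/-- The crossings of the chords `{x, f x}` of an involution `f`, recorded by the left endpoints. -/
def chordCrossings (f : Equiv.Perm P) : Finset (P × P) :=
  Finset.univ.filter fun z => z.1 < z.2 ∧ z.2 < f z.1 ∧ f z.1 < f z.2

/-- The product of the weights `q` over the crossings of `f`. -/
def crossingWeight (q : I → I → ℂ) (w : P → I) (f : Equiv.Perm P) : ℂ :=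
  ∏ z ∈ chordCrossings f, q (w z.1) (w z.2)

open Classical in
/-- The pairings of the positions in `S` which only pair positions with equal letters, as
involutions with support `S`. -/
def pairings (S : Finset P) (w : P → I) : Finset (Equiv.Perm P) :=
  Finset.univ.filter fun f => (∀ x, f (f x) = x) ∧ (∀ x, f x ≠ x ↔ x ∈ S) ∧ ∀ x, w (f x) = w x

/-- The sum of the crossing weights over all pairings. -/
def pairingSum (q : I → I → ℂ) (S : Finset P) (w : P → I) : ℂ :=
  ∑ f ∈ pairings S w, crossingWeight q w f

/-- `p < p'` are neighbours in `S`. -/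
structure AdjacentIn (S : Finset P) (p p' : P) : Prop where
  left_mem : p ∈ S
  right_mem : p' ∈ S
  lt : p < p'
  not_between : ∀ x ∈ S, p < x → x < p' → False

theorem mem_pairings {S : Finset P} {w : P → I} {f : Equiv.Perm P} :
    f ∈ pairings S w ↔
      (∀ x, f (f x) = x) ∧ (∀ x, f x ≠ x ↔ x ∈ S) ∧ ∀ x, w (f x) = w x := by
  simp [pairings]

theorem mem_chordCrossings {f : Equiv.Perm P} {z : P × P} :
    z ∈ chordCrossings f ↔ z.1 < z.2 ∧ z.2 < f z.1 ∧ f z.1 < f z.2 := by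
  simp [chordCrossings]

/-! ### Crossings under an adjacent transposition -/

theorem prod_filter_eq_mul_of_differ_at {A : Type*} [Fintype A] [DecidableEq A] (X Y : A → Prop)
    [DecidablePred X] [DecidablePred Y] (g : A → ℂ) (z : A) (h : ∀ a, a ≠ z → (X a ↔ Y a))
    (hz : X z ↔ ¬ Y z) (hg : g z * g z = 1) :
    ∏ a with X a, g a = g z * ∏ a with Y a, g a := by
  rw [Finset.prod_filter, Finset.prod_filter,
    ← Finset.mul_prod_erase _ _ (Finset.mem_univ z),
    ← Finset.mul_prod_erase (a := z) Finset.univ (fun a => if Y a then g a else 1)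
      (Finset.mem_univ z)]
  have : ∏ a ∈ Finset.univ.erase z, (if X a then g a else 1) =
      ∏ a ∈ Finset.univ.erase z, (if Y a then g a else 1) := by
    refine Finset.prod_congr rfl fun a ha => ?_
    simp only [h a (Finset.ne_of_mem_erase ha)]
  rw [this]
  by_cases hy : Y z
  · have hx : ¬ X z := fun h => (hz.mp h) hy
    rw [if_pos hy, if_neg hx, ← mul_assoc, hg]
  · rw [if_neg hy, if_pos (hz.mpr hy), one_mul]

-- A transposition of neighbours in `S` reverses the order of these two points only.
omit [Fintype P] in
theorem swap_lt_swap_iff {S : Finset P} {p p' : P} (h : AdjacentIn S p p') {x y : P} (hx : x ∈ S)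
    (hy : y ∈ S) (h1 : ¬ (x = p ∧ y = p')) (h2 : ¬ (x = p' ∧ y = p)) :
    Equiv.swap p p' x < Equiv.swap p p' y ↔ x < y := by
  have := h.lt
  have hbx := h.not_between x hx
  have hby := h.not_between y hy
  simp only [Equiv.swap_apply_def]
  grind

/-- Moving two neighbouring endpoints past each other toggles the crossing of the two chords ending
there and affects no other pair of chords. The witness `z` consists of the left endpoints of these
two chords, in the order in which they cross before or after the move. The primed chords are not
conjugated explicitly: the second triple of inequalities says that the swapped image of `a` is a
crossing of the conjugated involution. -/
theorem exists_crossing_differ {S : Finset P} {w : P → I} {f : Equiv.Perm P}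
    (hf : f ∈ pairings S w) {p p' : P} (h : AdjacentIn S p p') (hne : f p ≠ p') :
    ∃ z : P × P, ((w z.1 = w p ∧ w z.2 = w p') ∨ (w z.1 = w p' ∧ w z.2 = w p)) ∧
      (∀ a : P × P, a ≠ z → ((a.1 < a.2 ∧ a.2 < f a.1 ∧ f a.1 < f a.2) ↔
        (Equiv.swap p p' a.1 < Equiv.swap p p' a.2 ∧
          Equiv.swap p p' a.2 < Equiv.swap p p' (f a.1) ∧
          Equiv.swap p p' (f a.1) < Equiv.swap p p' (f a.2)))) ∧
      ((z.1 < z.2 ∧ z.2 < f z.1 ∧ f z.1 < f z.2) ↔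
        ¬ (Equiv.swap p p' z.1 < Equiv.swap p p' z.2 ∧
          Equiv.swap p p' z.2 < Equiv.swap p p' (f z.1) ∧
          Equiv.swap p p' (f z.1) < Equiv.swap p p' (f z.2))) := by
  obtain ⟨h1, h2, h3⟩ := mem_pairings.mp hf
  have hlt := h.lt
  have hb := h.not_between
  have hp := h.left_mem
  have hp' := h.right_mem
  have hr : f p ∈ S := by rw [← h2, h1]; exact ((h2 p).mpr hp).symm
  have hr' : f p' ∈ S := by rw [← h2, h1]; exact ((h2 p').mpr hp').symm
  have hrp := (h2 p).mpr hp
  have hrp' := (h2 p').mpr hp'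
  have hbr := hb _ hr
  have hbr' := hb _ hr'
  have hne' : f p' ≠ p := fun hc => hne (by rw [← hc, h1])
  have hrr : f p ≠ f p' := fun hc => hlt.ne (f.injective hc)
  have h3p := h3 p
  have h3p' := h3 p'
  have h1p := h1 p
  have h1p' := h1 p'
  have hsw : ∀ x, x ≠ p → x ≠ p' → Equiv.swap p p' x = x :=
    fun x => Equiv.swap_apply_of_ne_of_ne
  have swp : Equiv.swap p p' p = p' := Equiv.swap_apply_left ..
  have swp' : Equiv.swap p p' p' = p := Equiv.swap_apply_right ..
  have swr := hsw _ hrp hne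
  have swr' := hsw _ hne' hrp'
  -- A crossing is decided by three comparisons. Each can involve `p` and `p'` together for only two
  -- pairs, which gives the six exceptions; for all other pairs `swap_lt_swap_iff` applies three
  -- times.
  have gen : ∀ a : P × P, a ≠ (p, p') → a ≠ (p', p) → a ≠ (f p, p') → a ≠ (f p', p) →
      a ≠ (f p, f p') → a ≠ (f p', f p) →
      ((a.1 < a.2 ∧ a.2 < f a.1 ∧ f a.1 < f a.2) ↔
        (Equiv.swap p p' a.1 < Equiv.swap p p' a.2 ∧
          Equiv.swap p p' a.2 < Equiv.swap p p' (f a.1) ∧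
          Equiv.swap p p' (f a.1) < Equiv.swap p p' (f a.2))) := by
    rintro ⟨a, b⟩ n1 n2 n3 n4 n5 n6
    simp only [ne_eq, Prod.mk.injEq] at n1 n2 n3 n4 n5 n6
    have ha := h1 a
    have hb := h1 b
    have hsupp : ∀ x, f x ≠ x → x ∈ S ∧ f x ∈ S := fun x hx =>
      ⟨(h2 x).mp hx, (h2 _).mp (by rw [h1]; exact hx.symm)⟩
    by_cases hSa : f a = a
    · simp only [hSa]
      constructor <;> intro hc
      · exact absurd (hc.1.trans hc.2.1) (lt_irrefl _)
      · exact absurd (hc.1.trans hc.2.1) (lt_irrefl _)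
    by_cases hSb : f b = b
    · simp only [hSb]
      constructor <;> intro hc
      · exact absurd (hc.2.1.trans hc.2.2) (lt_irrefl _)
      · exact absurd (hc.2.1.trans hc.2.2) (lt_irrefl _)
    have sa := hsupp a hSa
    have sb := hsupp b hSb
    have e1 := swap_lt_swap_iff h sa.1 sb.1 n1 n2
    have e2 := swap_lt_swap_iff h sb.1 sa.2 (by grind) (by grind)
    have e3 := swap_lt_swap_iff h sa.2 sb.2 (by grind) (by grind)
    simp only [e1, e2, e3]
  have red : ∀ z : P × P, (∀ a ∈ [(p, p'), (p', p), (f p, p'), (f p', p), (f p, f p'), (f p', f p)],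
      a ≠ z → ((a.1 < a.2 ∧ a.2 < f a.1 ∧ f a.1 < f a.2) ↔
        (Equiv.swap p p' a.1 < Equiv.swap p p' a.2 ∧
          Equiv.swap p p' a.2 < Equiv.swap p p' (f a.1) ∧
          Equiv.swap p p' (f a.1) < Equiv.swap p p' (f a.2)))) →
      ∀ a : P × P, a ≠ z → ((a.1 < a.2 ∧ a.2 < f a.1 ∧ f a.1 < f a.2) ↔
        (Equiv.swap p p' a.1 < Equiv.swap p p' a.2 ∧
          Equiv.swap p p' a.2 < Equiv.swap p p' (f a.1) ∧
          Equiv.swap p p' (f a.1) < Equiv.swap p p' (f a.2))) := by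
    intro z hz a ha
    by_cases ham : a ∈ [(p, p'), (p', p), (f p, p'), (f p', p), (f p, f p'), (f p', f p)]
    · exact hz a ham ha
    · simp only [List.mem_cons, List.not_mem_nil, or_false, not_or] at ham
      exact gen a ham.1 ham.2.1 ham.2.2.1 ham.2.2.2.1 ham.2.2.2.2.1 ham.2.2.2.2.2
  simp only [List.forall_mem_cons, List.not_mem_nil, IsEmpty.forall_iff,
    h1p, h1p', swp, swp', swr, swr', ne_eq] at red
  have main : ∃ z ∈ [(p, p'), (p', p), (f p, p'), (f p', p), (f p, f p'), (f p', f p)],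
      (∀ a : P × P, a ≠ z → ((a.1 < a.2 ∧ a.2 < f a.1 ∧ f a.1 < f a.2) ↔
        (Equiv.swap p p' a.1 < Equiv.swap p p' a.2 ∧
          Equiv.swap p p' a.2 < Equiv.swap p p' (f a.1) ∧
          Equiv.swap p p' (f a.1) < Equiv.swap p p' (f a.2)))) ∧
      ((z.1 < z.2 ∧ z.2 < f z.1 ∧ f z.1 < f z.2) ↔
        ¬ (Equiv.swap p p' z.1 < Equiv.swap p p' z.2 ∧
          Equiv.swap p p' z.2 < Equiv.swap p p' (f z.1) ∧
          Equiv.swap p p' (f z.1) < Equiv.swap p p' (f z.2))) := by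
    -- The cases record whether `p` and `p'` are right or left endpoints. When both are of the same
    -- kind, the order of their partners decides which chord comes first in `z`.
    rcases lt_or_gt_of_ne hrp with c | c <;> rcases lt_or_gt_of_ne hrp' with c' | c'
    · rcases lt_or_gt_of_ne hrr with o | o
      · refine ⟨(f p, f p'), by simp, red _ ?_, ?_⟩
        all_goals simp only [h1p, h1p', swp, swp', swr, swr']
        all_goals grind
      · refine ⟨(f p', f p), by simp, red _ ?_, ?_⟩
        all_goals simp only [h1p, h1p', swp, swp', swr, swr']
        all_goals grind
    · refine ⟨(f p, p'), by simp, red _ ?_, ?_⟩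
      all_goals simp only [h1p, swp, swp', swr, swr']
      all_goals grind
    · refine ⟨(f p', p), by simp, red _ ?_, ?_⟩
      all_goals simp only [h1p', swp, swp', swr, swr']
      all_goals grind
    · rcases lt_or_gt_of_ne hrr with o | o
      · refine ⟨(p, p'), by simp, red _ ?_, ?_⟩
        all_goals simp only [swp, swp', swr, swr']
        all_goals grind
      · refine ⟨(p', p), by simp, red _ ?_, ?_⟩
        all_goals simp only [swp, swp', swr, swr']
        all_goals grind
  obtain ⟨z, hz, hz'⟩ := main
  refine ⟨z, ?_, hz'⟩
  simp only [List.mem_cons, List.not_mem_nil, or_false] at hz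
  rcases hz with rfl | rfl | rfl | rfl | rfl | rfl <;> simp [h3p, h3p']

/-- The toggled crossing contributes the factor `q (w p) (w p')`. Since this factor is its own
inverse, the formula is the same whether the crossing is created or destroyed. -/
theorem crossingWeight_swap {q : I → I → ℂ} (hsymm : ∀ u v, q u v = q v u) {S : Finset P}
    {w : P → I} {f : Equiv.Perm P} (hf : f ∈ pairings S w) {p p' : P} (h : AdjacentIn S p p')
    (hne : f p ≠ p') (hq : q (w p) (w p') * q (w p) (w p') = 1) :
    crossingWeight q w f = q (w p) (w p') *
      crossingWeight q (w ∘ Equiv.swap p p') (Equiv.swap p p' * f * Equiv.swap p p') := by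
  obtain ⟨z, hz, h1, h2⟩ := exists_crossing_differ hf h hne
  have hqz : q (w z.1) (w z.2) = q (w p) (w p') := by
    rcases hz with ⟨a, b⟩ | ⟨a, b⟩
    · rw [a, b]
    · rw [a, b, hsymm]
  have := prod_filter_eq_mul_of_differ_at _ _ (fun a : P × P => q (w a.1) (w a.2)) z h1 h2
    (by simp only [hqz, hq])
  rw [crossingWeight, chordCrossings, this]
  simp only [hqz]
  congr 1
  unfold crossingWeight
  refine Finset.prod_equiv ((Equiv.swap p p').prodCongr (Equiv.swap p p')) ?_ ?_
  · intro a
    rw [mem_chordCrossings]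
    simp
  · intro a _
    simp

theorem conj_swap_mem_pairings {S : Finset P} {w : P → I} {f : Equiv.Perm P}
    (hf : f ∈ pairings S w) {p p' : P} (hp : p ∈ S) (hp' : p' ∈ S) :
    Equiv.swap p p' * f * Equiv.swap p p' ∈ pairings S (w ∘ Equiv.swap p p') := by
  obtain ⟨h1, h2, h3⟩ := mem_pairings.mp hf
  refine mem_pairings.mpr ⟨fun x => by simp [h1], fun x => ?_, fun x => by simp [h3]⟩
  have : Equiv.swap p p' x ∈ S ↔ x ∈ S := by
    simp only [Equiv.swap_apply_def]
    split_ifs <;> simp_all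
  rw [← this, ← h2]
  simp only [Equiv.Perm.coe_mul, Function.comp_apply, ne_eq]
  rw [Equiv.swap_apply_eq_iff]

/-- Conjugation by the transposition is a bijection of the pairings that do not join `p` to `p'`,
and it multiplies each weight by the same sign. -/
theorem sum_swap {q : I → I → ℂ} (hsymm : ∀ u v, q u v = q v u) {S : Finset P}
    (w : P → I) {p p' : P} (h : AdjacentIn S p p')
    (hq : q (w p) (w p') * q (w p) (w p') = 1) :
    ∑ f ∈ pairings S w with f p ≠ p', crossingWeight q w f =
      q (w p) (w p') * ∑ f ∈ pairings S (w ∘ Equiv.swap p p') with f p ≠ p',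
        crossingWeight q (w ∘ Equiv.swap p p') f := by
  rw [Finset.mul_sum]
  have hw : (w ∘ Equiv.swap p p') ∘ Equiv.swap p p' = w := by
    ext x; simp
  have hconj : ∀ f : Equiv.Perm P,
      Equiv.swap p p' * (Equiv.swap p p' * f * Equiv.swap p p') * Equiv.swap p p' = f := by
    intro f; ext x; simp
  have hne : ∀ f : Equiv.Perm P, (∀ x, f (f x) = x) → f p ≠ p' →
      (Equiv.swap p p' * f * Equiv.swap p p') p ≠ p' := by
    intro f hf hfp hc
    simp only [Equiv.Perm.coe_mul, Function.comp_apply, Equiv.swap_apply_left] at hc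
    rw [Equiv.swap_apply_eq_iff, Equiv.swap_apply_right] at hc
    exact hfp (by rw [← hc, hf])
  refine Finset.sum_bij' (fun f _ => Equiv.swap p p' * f * Equiv.swap p p')
    (fun f _ => Equiv.swap p p' * f * Equiv.swap p p') ?_ ?_ ?_ ?_ ?_
  · intro f hf
    rw [Finset.mem_filter] at hf ⊢
    exact ⟨conj_swap_mem_pairings hf.1 h.left_mem h.right_mem,
      hne f (mem_pairings.mp hf.1).1 hf.2⟩
  · intro f hf
    rw [Finset.mem_filter] at hf ⊢
    have := conj_swap_mem_pairings hf.1 h.left_mem h.right_mem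
    rw [hw] at this
    exact ⟨this, hne f (mem_pairings.mp hf.1).1 hf.2⟩
  · intro f _; exact hconj f
  · intro f _; exact hconj f
  · intro f hf
    rw [Finset.mem_filter] at hf
    exact crossingWeight_swap hsymm hf.1 h hf.2 hq

/-- A chord joining neighbours crosses nothing, so deleting it keeps the weight. Multiplying by the
transposition deletes or restores this chord. -/
theorem sum_paired (q : I → I → ℂ) {S : Finset P} (w : P → I) {p p' : P}
    (h : AdjacentIn S p p') (hw : w p = w p') :
    ∑ f ∈ pairings S w with f p = p', crossingWeight q w f =
      pairingSum q ((S.erase p).erase p') w := by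
  have hlt := h.lt
  have hp := h.left_mem
  have hp' := h.right_mem
  have hb := h.not_between
  have hmem1 : ∀ f ∈ pairings S w, f p = p' →
      f * Equiv.swap p p' ∈ pairings ((S.erase p).erase p') w := by
    intro f hf hfp
    obtain ⟨h1, h2, h3⟩ := mem_pairings.mp hf
    have hfp' : f p' = p := by rw [← hfp, h1]
    rw [mem_pairings]
    simp only [Equiv.Perm.coe_mul, Function.comp_apply, Equiv.swap_apply_def, Finset.mem_erase]
    refine ⟨fun x => ?_, fun x => ?_, fun x => ?_⟩
    · have := h1 x
      grind
    · have := h2 x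
      grind
    · have := h3 x
      grind
  have hmem2 : ∀ f ∈ pairings ((S.erase p).erase p') w,
      f p = p ∧ f p' = p' ∧ f * Equiv.swap p p' ∈ pairings S w := by
    intro f hf
    obtain ⟨h1, h2, h3⟩ := mem_pairings.mp hf
    simp only [Finset.mem_erase] at h2
    have hfp : f p = p := by by_contra hc; simpa using (h2 p).mp hc
    have hfp' : f p' = p' := by by_contra hc; simpa using (h2 p').mp hc
    refine ⟨hfp, hfp', ?_⟩
    rw [mem_pairings]
    simp only [Equiv.Perm.coe_mul, Function.comp_apply, Equiv.swap_apply_def]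
    refine ⟨fun x => ?_, fun x => ?_, fun x => ?_⟩
    · have := h1 x
      grind
    · have := h2 x
      grind
    · have := h3 x
      grind
  unfold pairingSum
  refine Finset.sum_bij' (fun f _ => f * Equiv.swap p p') (fun f _ => f * Equiv.swap p p')
    ?_ ?_ ?_ ?_ ?_
  · intro f hf
    rw [Finset.mem_filter] at hf
    exact hmem1 f hf.1 hf.2
  · intro f hf
    rw [Finset.mem_filter]
    refine ⟨(hmem2 f hf).2.2, ?_⟩
    simp [(hmem2 f hf).2.1]
  · intro f _; ext x; simp
  · intro f _; ext x; simp
  · intro f hf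
    rw [Finset.mem_filter] at hf
    obtain ⟨hf, hfp⟩ := hf
    obtain ⟨h1, h2, h3⟩ := mem_pairings.mp hf
    have hfp' : f p' = p := by rw [← hfp, h1]
    unfold crossingWeight
    congr 1
    ext ⟨a, b⟩
    simp only [mem_chordCrossings, Equiv.Perm.coe_mul, Function.comp_apply,
      Equiv.swap_apply_def]
    have ha := h2 a
    have hbb := h2 b
    have hfa := h2 (f a)
    have hfb := h2 (f b)
    rw [h1] at hfa hfb
    have k1 := hb a
    have k2 := hb b
    have k3 := hb (f a)
    have k4 := hb (f b)
    grind

/-- With equal letters the exchange leaves the word unchanged, so the pairings not joining `p` to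
`p'` have a sum equal to its own negative, hence zero. Only the pairings containing the short chord
remain. -/
theorem pairingSum_cancel {q : I → I → ℂ} (hsymm : ∀ u v, q u v = q v u)
    (hdiag : ∀ u, q u u = -1) {S : Finset P} (w : P → I) {p p' : P} (h : AdjacentIn S p p')
    (hw : w p = w p') : pairingSum q S w = pairingSum q ((S.erase p).erase p') w := by
  have hw' : w ∘ Equiv.swap p p' = w := by
    ext x
    simp only [Function.comp_apply, Equiv.swap_apply_def]
    split_ifs <;> simp_all
  have h1 := sum_swap hsymm w h (by rw [hw, hdiag]; norm_num)
  rw [hw', hw, hdiag] at h1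
  have h2 := sum_paired q w h hw
  have h3 := Finset.sum_filter_add_sum_filter_not (pairings S w) (fun f => f p = p')
    (crossingWeight q w)
  unfold pairingSum at h2 ⊢
  linear_combination -h3 + h2 + h1 / 2

/-- Different letters are never paired, so `sum_swap` already covers all pairings. -/
theorem pairingSum_swap {q : I → I → ℂ} (hsymm : ∀ u v, q u v = q v u) {S : Finset P}
    (w : P → I) {p p' : P} (h : AdjacentIn S p p')
    (hq : q (w p) (w p') * q (w p) (w p') = 1) (hw : w p ≠ w p') :
    pairingSum q S w = q (w p) (w p') * pairingSum q S (w ∘ Equiv.swap p p') := by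
  have key : ∀ v : P → I, v p ≠ v p' →
      pairingSum q S v = ∑ f ∈ pairings S v with f p ≠ p', crossingWeight q v f := by
    intro v hv
    unfold pairingSum
    rw [Finset.filter_true_of_mem]
    rintro f hf rfl
    exact hv ((mem_pairings.mp hf).2.2 p).symm
  rw [key w hw, key _ (by simpa using hw.symm), sum_swap hsymm w h hq]

theorem pairingSum_empty (q : I → I → ℂ) (w : P → I) : pairingSum q ∅ w = 1 := by
  have : pairings ∅ w = {1} := by
    ext f
    rw [mem_pairings, Finset.mem_singleton]
    constructor
    · rintro ⟨-, h, -⟩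
      ext x
      simpa using h x
    · rintro rfl
      simp
  rw [pairingSum, this, Finset.sum_singleton, crossingWeight, Finset.prod_eq_one]
  rintro ⟨a, b⟩ h
  simp only [mem_chordCrossings, Equiv.Perm.coe_one, id_eq] at h
  exact absurd (h.1.trans h.2.1) (lt_irrefl _)

end Pairings

/-! ### The moment functional determined by the commutation relations -/

section Moments

variable {P I K : Type*} [LinearOrder P] [Fintype P]

/-- Take a chord spanning the fewest points of `S`. Nonzero weight forces crossing chords into the
same copy, so a point of another copy under this chord would belong to a chord nested strictly
inside it, contradicting minimality. -/
theorem exists_pair_within_copy {q : I → I → ℂ} {copy : I → K}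
    (hmix : ∀ u v, copy u ≠ copy v → q u v = 0) {S : Finset P} {w : P → I} (hS : S.Nonempty)
    {f : Equiv.Perm P} (hf : f ∈ pairings S w) (hwt : crossingWeight q w f ≠ 0) :
    ∃ x ∈ S, x < f x ∧ ∀ y ∈ S, x ≤ y → y ≤ f x → copy (w y) = copy (w x) := by
  obtain ⟨h1, h2, h3⟩ := mem_pairings.mp hf
  have hcr : ∀ a b, a < b → b < f a → f a < f b → copy (w a) = copy (w b) := by
    intro a b hab hb hfa
    by_contra hc
    exact hwt (Finset.prod_eq_zero (mem_chordCrossings.mpr ⟨hab, hb, hfa⟩ :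
      (a, b) ∈ chordCrossings f) (hmix _ _ hc))
  have hmem : ∀ x ∈ S, f x ∈ S := fun x hx =>
    (h2 _).mp (by rw [h1]; exact ((h2 x).mpr hx).symm)
  obtain ⟨x, hx, hmin⟩ := Finset.exists_min_image (S.filter fun x => x < f x)
    (fun x => (S.filter fun y => x ≤ y ∧ y ≤ f x).card) (by
      obtain ⟨x, hx⟩ := hS
      rcases lt_or_gt_of_ne ((h2 x).mpr hx) with h | h
      · exact ⟨f x, Finset.mem_filter.mpr ⟨hmem x hx, by rwa [h1]⟩⟩
      · exact ⟨x, Finset.mem_filter.mpr ⟨hx, h⟩⟩)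
  rw [Finset.mem_filter] at hx
  refine ⟨x, hx.1, hx.2, fun y hy hxy hyf => ?_⟩
  by_contra hc
  have hyx : x ≠ y := by rintro rfl; exact hc rfl
  have hyfx : y ≠ f x := by rintro rfl; exact hc (by rw [h3])
  have hlt1 := lt_of_le_of_ne hxy hyx
  have hlt2 := lt_of_le_of_ne hyf hyfx
  have k1 := hcr x y hlt1 hlt2
  have hle : f y < f x := by
    by_contra hle
    have : f x < f y := lt_of_le_of_ne (not_lt.mp hle) (fun h => hyx (f.injective h))
    exact hc (k1 this).symm
  have hge : x < f y := by
    by_contra hge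
    have : f y < x := lt_of_le_of_ne (not_lt.mp hge) (fun h => hyfx (by rw [← h, h1]))
    have := hcr (f y) x this (by rwa [h1]) (by rwa [h1])
    rw [h3] at this
    exact hc this
  -- A chord strictly inside spans fewer points, since it misses `x`.
  have small : ∀ z ∈ S, z < f z → x < z → f z < f x → False := by
    intro z hz hzf hxz hzx
    have := hmin z (Finset.mem_filter.mpr ⟨hz, hzf⟩)
    refine absurd (Finset.card_lt_card (Finset.ssubset_iff_of_subset ?_ |>.mpr ?_))
      (not_lt.mpr this)
    · intro t ht
      rw [Finset.mem_filter] at ht ⊢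
      exact ⟨ht.1, hxz.le.trans ht.2.1, ht.2.2.trans hzx.le⟩
    · refine ⟨x, Finset.mem_filter.mpr ⟨hx.1, le_rfl, hx.2.le⟩, fun h => ?_⟩
      exact absurd (Finset.mem_filter.mp h).2.1 (not_le.mpr hxz)
  rcases lt_or_gt_of_ne ((h2 y).mpr hy) with h | h
  · exact small (f y) (hmem y hy) (by rwa [h1]) hge (by rwa [h1])
  · exact small y hy h hlt1 hle

/-- The increase between neighbours propagates along a stretch of a single copy, by induction
through the predecessor of `y` in `S`. -/
theorem lt_of_adjacent_lt [LinearOrder I] {copy : I → K} {S : Finset P} {w : P → I}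
    (hadj : ∀ p p', AdjacentIn S p p' → copy (w p) = copy (w p') → w p < w p') {x : P}
    (hx : x ∈ S) (y : P) (hy : y ∈ S) (hxy : x < y)
    (hc : ∀ z ∈ S, x ≤ z → z ≤ y → copy (w z) = copy (w x)) : w x < w y := by
  induction y using WellFoundedLT.induction with
  | ind y ih =>
    obtain ⟨z, hz, hmax⟩ := Finset.exists_max_image (S.filter fun z => x ≤ z ∧ z < y) id
      ⟨x, Finset.mem_filter.mpr ⟨hx, le_rfl, hxy⟩⟩
    rw [Finset.mem_filter] at hz
    have hlt : w z < w y := by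
      refine hadj z y ⟨hz.1, hy, hz.2.2, fun t ht h1 h2 => ?_⟩ ?_
      · exact absurd (hmax t (Finset.mem_filter.mpr ⟨ht, hz.2.1.trans h1.le, h2⟩))
          (not_le.mpr h1)
      · rw [hc z hz.1 hz.2.1 hz.2.2.le, hc y hy hxy.le le_rfl]
    rcases hz.2.1.eq_or_lt with rfl | hlt'
    · exact hlt
    · exact (ih z hz.2.2 hz.1 hlt' fun t ht h1 h2 => hc t ht h1 (h2.trans hz.2.2.le)).trans hlt

/-- A pairing of nonzero weight has a chord over a single copy; its two ends carry the same letter,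
yet the letters increase strictly along it. -/
theorem pairingSum_eq_zero_of_reduced [LinearOrder I] {q : I → I → ℂ} {copy : I → K}
    (hmix : ∀ u v, copy u ≠ copy v → q u v = 0) {S : Finset P} {w : P → I} (hS : S.Nonempty)
    (hadj : ∀ p p', AdjacentIn S p p' → copy (w p) = copy (w p') → w p < w p') :
    pairingSum q S w = 0 := by
  refine Finset.sum_eq_zero fun f hf => ?_
  by_contra hwt
  obtain ⟨x, hx, hlt, hc⟩ := exists_pair_within_copy hmix hS hf hwt
  obtain ⟨h1, h2, h3⟩ := mem_pairings.mp hf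
  have := lt_of_adjacent_lt hadj hx (f x) ((h2 _).mp (by rw [h1]; exact hlt.ne)) hlt hc
  rw [h3] at this
  exact lt_irrefl _ this

omit [Fintype P] in
theorem adjacentIn_of_sort_eq {S : Finset P} {p p' : P} {l₁ l₂ : List P}
    (h : S.sort (· ≤ ·) = l₁ ++ p :: p' :: l₂) :
    AdjacentIn S p p' ∧ ((S.erase p).erase p').sort (· ≤ ·) = l₁ ++ l₂ ∧
      (∀ x ∈ l₁, x < p) ∧ ∀ x ∈ l₂, p' < x := by
  have hs : (l₁ ++ p :: p' :: l₂).Pairwise (· < ·) := h ▸ (Finset.sortedLT_sort S).pairwise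
  have hmem : ∀ x, x ∈ S ↔ x ∈ l₁ ∨ x = p ∨ x = p' ∨ x ∈ l₂ := by
    intro x
    rw [← Finset.mem_sort (· ≤ ·), h]
    simp
  have hs' := hs
  rw [List.pairwise_append, List.pairwise_cons, List.pairwise_cons] at hs
  obtain ⟨a1, ⟨a2, a3, a4⟩, a5⟩ := hs
  have b1 : ∀ x ∈ l₁, x < p := fun x hx => a5 x hx p (by simp)
  have b2 : ∀ x ∈ l₂, p' < x := a3
  have hlt : p < p' := a2 p' (by simp)
  refine ⟨⟨(hmem p).mpr (by simp), (hmem p').mpr (by simp), hlt, fun x hx h1 h2 => ?_⟩, ?_, b1, b2⟩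
  · rcases (hmem x).mp hx with hx | rfl | rfl | hx
    · exact absurd (b1 x hx) (not_lt.mpr h1.le)
    · exact lt_irrefl _ h1
    · exact lt_irrefl _ h2
    · exact absurd (b2 x hx) (not_lt.mpr h2.le)
  · have hp : (l₁ ++ l₂).Pairwise (· < ·) := hs'.sublist (by
      apply List.Sublist.append_left
      exact (List.sublist_cons_self _ _).trans (List.sublist_cons_self _ _))
    have : (S.erase p).erase p' = (l₁ ++ l₂).toFinset := by
      ext x
      simp only [Finset.mem_erase, hmem, List.toFinset_append, Finset.mem_union,
        List.mem_toFinset]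
      have := b1 x
      have := b2 x
      grind
    rw [this]
    exact (List.toFinset_sort (· ≤ ·) hp.nodup).mpr (hp.imp le_of_lt)

/-- A functional on words which satisfies the commutation relations inside each copy and vanishes
on nonempty reduced words is the sum of the crossing weights over the pairings. -/
theorem eq_pairingSum [LinearOrder I] [Finite I] {q : I → I → ℂ} {copy : I → K}
    (hsymm : ∀ u v, q u v = q v u) (hdiag : ∀ u, q u u = -1)
    (hsq : ∀ u v, copy u = copy v → q u v * q u v = 1)
    (hmix : ∀ u v, copy u ≠ copy v → q u v = 0)
    (F : List I → ℂ) (hnil : F [] = 1)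
    (hcancel : ∀ l₁ l₂ u, F (l₁ ++ u :: u :: l₂) = F (l₁ ++ l₂))
    (hswap : ∀ l₁ l₂ u v, copy u = copy v → u ≠ v →
      F (l₁ ++ u :: v :: l₂) = q u v * F (l₁ ++ v :: u :: l₂))
    (hred : ∀ l, l ≠ [] → l.IsChain (fun u v => copy u = copy v → u < v) → F l = 0)
    (S : Finset P) (w : P → I) :
    F ((S.sort (· ≤ ·)).map w) = pairingSum q S w := by
  -- The outer induction serves cancellation, which removes two positions. The inner one, on the
  -- word in the lexicographic order, serves exchanges; that order is well founded because positions
  -- and letters are finite in number.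
  induction hn : S.card using Nat.strong_induction_on generalizing S w with
  | _ n ihn =>
  subst hn
  induction hv : toLex w using WellFoundedLT.induction generalizing w with
  | ind v ihw =>
  subst hv
  by_cases hch : ((S.sort (· ≤ ·)).map w).IsChain (fun u v => copy u = copy v → u < v)
  · rcases S.eq_empty_or_nonempty with rfl | hS
    · rw [pairingSum_empty, Finset.sort_empty, List.map_nil, hnil]
    · rw [hred _ (by
        simpa [← List.length_pos_iff_ne_nil] using hS) hch]
      refine (pairingSum_eq_zero_of_reduced hmix hS fun p p' hpp => ?_).symm
      rw [List.isChain_map] at hch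
      obtain ⟨l₁, l₂, hl⟩ := List.append_of_mem ((Finset.mem_sort (· ≤ ·)).mpr hpp.left_mem)
      have hs : (l₁ ++ p :: l₂).Pairwise (· < ·) := hl ▸ (Finset.sortedLT_sort S).pairwise
      rw [List.pairwise_append, List.pairwise_cons] at hs
      have hp' : p' ∈ l₁ ++ p :: l₂ := hl ▸ (Finset.mem_sort (· ≤ ·)).mpr hpp.right_mem
      have hlt := hpp.lt
      have hp'2 : p' ∈ l₂ := by
        rcases List.mem_append.mp hp' with h | h
        · exact absurd (hs.2.2 p' h p (by simp)) (not_lt.mpr hlt.le)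
        · rcases List.mem_cons.mp h with h | h
          · exact absurd h hlt.ne'
          · exact h
      rcases l₂ with _ | ⟨z, l₂⟩
      · simp at hp'2
      have hz : z = p' := by
        rcases List.mem_cons.mp hp'2 with h | h
        · exact h.symm
        · have h1 : z < p' := (List.pairwise_cons.mp hs.2.1.2).1 p' h
          have hzS : z ∈ S := by rw [← Finset.mem_sort (· ≤ ·), hl]; simp
          exact (hpp.not_between z hzS (hs.2.1.1 z (by simp)) h1).elim
      subst hz
      exact (List.isChain_iff_forall_rel_of_append_cons_cons.mp hch) hl
  · rw [List.isChain_map, List.isChain_iff_forall_rel_of_append_cons_cons] at hch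
    push Not at hch
    -- A word that is not reduced has neighbours of one copy that are equal or in decreasing order:
    -- cancel them or exchange them.
    obtain ⟨p, p', l₁, l₂, hl, hcopy, hle⟩ := hch
    obtain ⟨hadj, hsort, hl1, hl2⟩ := adjacentIn_of_sort_eq hl
    have hF : F ((S.sort (· ≤ ·)).map w) = F (l₁.map w ++ w p :: w p' :: l₂.map w) := by
      rw [hl, List.map_append, List.map_cons, List.map_cons]
    rcases hle.eq_or_lt with heq | hlt
    · rw [hF, heq, hcancel, pairingSum_cancel hsymm hdiag w hadj heq.symm, ← List.map_append,
        ← hsort]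
      refine ihn _ (Finset.card_lt_card ?_) _ w rfl
      refine (Finset.erase_subset _ _).trans_ssubset (Finset.erase_ssubset hadj.left_mem)
    · rw [hF, hswap _ _ _ _ hcopy hlt.ne', pairingSum_swap hsymm w hadj (hsq _ _ hcopy) hlt.ne']
      congr 1
      rw [← ihw (toLex (w ∘ Equiv.swap p p')) ?_ _ rfl, hl]
      · congr 1
        have e1 : l₁.map (w ∘ Equiv.swap p p') = l₁.map w := List.map_congr_left fun x hx => by
          have := hl1 x hx
          simp [Equiv.swap_apply_of_ne_of_ne this.ne (this.trans hadj.lt).ne]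
        have e2 : l₂.map (w ∘ Equiv.swap p p') = l₂.map w := List.map_congr_left fun x hx => by
          have := hl2 x hx
          simp [Equiv.swap_apply_of_ne_of_ne (hadj.lt.trans this).ne' this.ne']
        rw [List.map_append, List.map_cons, List.map_cons, e1, e2]
        simp
      -- The first position at which the exchanged word differs is `p`, and its letter there has
      -- become smaller.
      · refine ⟨p, fun j hj => ?_, ?_⟩
        · simp [Equiv.swap_apply_of_ne_of_ne hj.ne (hj.trans hadj.lt).ne]
        · simpa using hlt

end Moments

/-! ### Moments of the spin algebra -/

section SpinMoments

variable {I : Type*} [LinearOrder I]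

theorem gen_mul_gen (ε : SignFunction I) (u v : I) (huv : u ≠ v) :
    SpinAlgebra.gen ε u * SpinAlgebra.gen ε v =
      ((ε.sign u v : ℤ) : ℂ) • (SpinAlgebra.gen ε v * SpinAlgebra.gen ε u) := by
  have := RingQuot.mkAlgHom_rel ℂ (SpinRel.rel (ε := ε) u v)
  rw [if_neg huv, map_zero, map_sub, map_smul, map_mul, map_mul, sub_eq_zero] at this
  exact this

theorem gen_mul_self (ε : SignFunction I) (u : I) :
    SpinAlgebra.gen ε u * SpinAlgebra.gen ε u = 1 := by
  have := RingQuot.mkAlgHom_rel ℂ (SpinRel.rel (ε := ε) u u)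
  rw [if_pos rfl, map_sub, map_smul, map_mul, ε.diag, map_ofNat] at this
  have h2 : (2 : ℂ) • (SpinAlgebra.gen ε u * SpinAlgebra.gen ε u) = (2 : ℂ) • 1 := by
    have h1 : (((-1 : ℤˣ) : ℤ) : ℂ) = -1 := by simp
    rw [h1] at this
    have h2 : (-1 : ℂ) • (SpinAlgebra.gen ε u * SpinAlgebra.gen ε u) =
        -(SpinAlgebra.gen ε u * SpinAlgebra.gen ε u) := by
      rw [eq_neg_iff_add_eq_zero]
      nth_rewrite 2 [← one_smul ℂ (SpinAlgebra.gen ε u * SpinAlgebra.gen ε u)]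
      rw [← add_smul, neg_add_cancel, zero_smul]
    have h3 : SpinAlgebra.gen ε u * SpinAlgebra.gen ε u -
        (-1 : ℂ) • (SpinAlgebra.gen ε u * SpinAlgebra.gen ε u) = 2 := this
    rw [two_smul, two_smul, one_add_one_eq_two, ← h3, h2, sub_neg_eq_add]
  exact smul_right_injective _ (two_ne_zero (α := ℂ)) h2

variable [Fintype I]

theorem spinTrace_prod_of_sorted (ε : SignFunction I) (l : List I) (hl : l ≠ [])
    (h : l.Pairwise (· < ·)) : spinTrace ε (l.map (SpinAlgebra.gen ε)).prod = 0 := by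
  have := spinTrace_monomial ε l.toFinset
  rw [SpinAlgebra.monomial, (List.toFinset_sort (· ≤ ·) h.nodup).mpr (h.imp le_of_lt),
    if_neg (by simpa using hl)] at this
  exact this

theorem spinTrace_one (ε : SignFunction I) : spinTrace ε 1 = 1 := by
  simp [spinTrace]

/-- With a single copy every pair of generators may be exchanged, and the reduced words are the
strictly increasing products, on which the trace vanishes unless they are empty. -/
theorem spinTrace_ofFn_prod (ε : SignFunction I) {s : ℕ} (w : Fin s → I) :
    spinTrace ε (List.ofFn fun j => SpinAlgebra.gen ε (w j)).prod =
      pairingSum (fun u v => ((ε.sign u v : ℤ) : ℂ)) Finset.univ w := by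
  rw [← eq_pairingSum (copy := fun _ : I => ()) (q := fun u v => ((ε.sign u v : ℤ) : ℂ))
    ?_ ?_ ?_ ?_ (fun l => spinTrace ε (l.map (SpinAlgebra.gen ε)).prod) ?_ ?_ ?_ ?_]
  · rw [Fin.sort_univ, List.map_map, List.ofFn_eq_map]
    rfl
  · intro u v
    simp only [ε.symm u v]
  · intro u
    simp [ε.diag]
  · intro u v _
    have h : ((ε.sign u v * ε.sign u v : ℤˣ) : ℤ) = 1 := by rw [Int.units_mul_self]; rfl
    rw [Units.val_mul] at h
    exact_mod_cast h
  · simp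
  · simp [spinTrace_one]
  · intro l₁ l₂ u
    simp only [List.map_append, List.map_cons, List.prod_append, List.prod_cons]
    rw [← mul_assoc (SpinAlgebra.gen ε u), gen_mul_self, one_mul]
  · intro l₁ l₂ u v _ huv
    simp only [List.map_append, List.map_cons, List.prod_append, List.prod_cons]
    rw [← mul_assoc (SpinAlgebra.gen ε u), gen_mul_gen ε u v huv, smul_mul_assoc,
      mul_smul_comm, map_smul, smul_eq_mul, mul_assoc]
  · intro l hl hch
    refine spinTrace_prod_of_sorted ε l hl ?_
    rw [← List.isChain_iff_pairwise]
    exact hch.imp fun u v h => h rfl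

end SpinMoments

/-! ### Moments of the free product -/

section FreeMoments

variable {n d : ℕ}

/-- In coordinates the matrix acts on the left part of copy `α` with the tail fixed, so composition
of operators becomes multiplication of matrices. -/
theorem freeAction_apply (α : Fin n) (T : Matrix (Finset (Fin d)) (Finset (Fin d)) ℂ)
    (f : FreeFock n d) (w : ReducedWord n d) :
    (freeAction α T f) w = ∑ C, T (w.head α) C * f (w.replaceHead α C) := by
  have h : ∀ B C, (unitAction α B C f) w = if w.head α = B then f (w.replaceHead α C) else 0 :=
    fun _ _ => rfl
  simp only [freeAction, sum_apply, smul_apply, lp.coeFn_sum, Finset.sum_apply, lp.coeFn_smul,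
    Pi.smul_apply, h, smul_eq_mul]
  rw [Finset.sum_eq_single (w.head α)]
  · simp
  · intro B _ hB
    simp [hB.symm]
  · simp

theorem freeAction_mul (α : Fin n) (T T' : Matrix (Finset (Fin d)) (Finset (Fin d)) ℂ) :
    freeAction α (T * T') = freeAction α T * freeAction α T' := by
  ext f w
  rw [mul_apply_eq_comp, freeAction_apply, freeAction_apply]
  simp only [freeAction_apply, Matrix.mul_apply, Finset.sum_mul, Finset.mul_sum,
    ReducedWord.replaceHead, ReducedWord.head_cons, ReducedWord.tail_cons]
  rw [Finset.sum_comm]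
  simp only [mul_assoc]

theorem freeAction_one (α : Fin n) :
    freeAction α (1 : Matrix (Finset (Fin d)) (Finset (Fin d)) ℂ) = 1 := by
  ext f w
  rw [freeAction_apply, Finset.sum_eq_single (w.head α)]
  · rw [Matrix.one_apply_eq, one_mul, ReducedWord.replaceHead, ReducedWord.cons_head_tail]
    rfl
  · intro B _ hB
    rw [Matrix.one_apply_ne hB.symm, zero_mul]
  · simp

theorem freeAction_neg (α : Fin n) (T : Matrix (Finset (Fin d)) (Finset (Fin d)) ℂ) :
    freeAction α (-T) = -freeAction α T := by
  simp [freeAction]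

theorem cliffordRep_gen (i : Fin d) :
    cliffordRep d (Clifford.gen i) = spinMatrix (SignFunction.allNeg (Fin d)) i := by
  rw [cliffordRep, Clifford.gen, CliffordAlgebra.lift_ι_apply, LinearMap.sum_apply,
    Finset.sum_eq_single i]
  · simp
  · intro j _ hj
    simp [hj]
  · simp

theorem cliffordAction_gen_mul_gen (α : Fin n) {i j : Fin d} (hij : i ≠ j) :
    cliffordAction α (Clifford.gen i) * cliffordAction α (Clifford.gen j) =
      -(cliffordAction α (Clifford.gen j) * cliffordAction α (Clifford.gen i)) := by
  simp only [cliffordAction, cliffordRep_gen]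
  rw [← freeAction_mul, ← freeAction_mul, ← freeAction_neg]
  congr 1
  have := spinMatrix_rel (SignFunction.allNeg (Fin d)) i j
  have hs : (SignFunction.allNeg (Fin d)).sign i j = -1 := rfl
  rw [if_neg hij, hs] at this
  rw [eq_neg_iff_add_eq_zero]
  simpa using this

theorem cliffordAction_gen_mul_self (α : Fin n) (i : Fin d) :
    cliffordAction α (Clifford.gen i) * cliffordAction α (Clifford.gen i) = 1 := by
  simp only [cliffordAction, cliffordRep_gen]
  rw [← freeAction_mul, ← freeAction_one α]
  congr 1
  have := spinMatrix_rel (SignFunction.allNeg (Fin d)) i i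
  have hs : (SignFunction.allNeg (Fin d)).sign i i = -1 := rfl
  rw [if_pos rfl, hs] at this
  have h2 : (2 : ℂ) • (spinMatrix (SignFunction.allNeg (Fin d)) i *
      spinMatrix (SignFunction.allNeg (Fin d)) i) = (2 : ℂ) • 1 := by
    rw [two_smul, two_smul, one_add_one_eq_two, ← this]
    simp
  exact smul_right_injective _ (two_ne_zero (α := ℂ)) h2

theorem cliffordAction_gen_single (α : Fin n) (i : Fin d) (w : ReducedWord n d) :
    cliffordAction α (Clifford.gen i) (lp.single 2 w 1) =
      ((moveSign (SignFunction.allNeg (Fin d)) i (w.head α) : ℤ) : ℂ) •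
        (lp.single 2 (w.replaceHead α (symmDiff (w.head α) {i})) 1 : FreeFock n d) := by
  have h := freeAction_single α (spinMatrix (SignFunction.allNeg (Fin d)) i) (w.head α)
    (w.tail α) (w.tail_avoids α)
  rw [ReducedWord.cons_head_tail] at h
  rw [cliffordAction, cliffordRep_gen, h, Finset.sum_eq_single (symmDiff (w.head α) {i})]
  · simp [spinMatrix, ReducedWord.replaceHead]
  · intro B _ hB
    simp [spinMatrix, hB]
  · simp

theorem ReducedWord.head_eq_empty_of_ne {w : ReducedWord n d} {α β : Fin n}
    (h : (w.head α).Nonempty) (hne : α ≠ β) : w.head β = ∅ := by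
  rcases w with ⟨_ | ⟨x, l⟩, h1, h2⟩
  · rfl
  · simp only [head, headPart] at h ⊢
    split_ifs at h with hx
    · rw [if_neg (by rw [hx]; exact hne)]
    · simp at h

/-- The product of the generators of the free product over a word. -/
def freeWord (l : List (Fin n ×ₗ Fin d)) : FreeFock n d →L[ℂ] FreeFock n d :=
  (l.map fun u => cliffordAction (ofLex u).1 (Clifford.gen (ofLex u).2)).prod

/-- In a reduced word each generator, applied from the right, only creates: it either opens a new
letter or adds an index smaller than all those in the current head. The membership and minimality
clauses are what the induction needs, and membership shows that the resulting basis vector is not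
the vacuum. -/
theorem freeWord_vacuum_of_reduced (u : Fin n ×ₗ Fin d) (l : List (Fin n ×ₗ Fin d))
    (h : (u :: l).IsChain (fun u v => (ofLex u).1 = (ofLex v).1 → u < v)) :
    ∃ (c : ℂ) (w : ReducedWord n d), freeWord (u :: l) (vacuum n d) = c • lp.single 2 w 1 ∧
      (ofLex u).2 ∈ w.head (ofLex u).1 ∧ ∀ a ∈ w.head (ofLex u).1, (ofLex u).2 ≤ a := by
  have step : ∀ (u : Fin n ×ₗ Fin d) (l : List (Fin n ×ₗ Fin d)) (c : ℂ) (w : ReducedWord n d),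
      freeWord l (vacuum n d) = c • lp.single 2 w 1 →
      (∀ a ∈ w.head (ofLex u).1, (ofLex u).2 < a) →
      ∃ (c : ℂ) (w : ReducedWord n d), freeWord (u :: l) (vacuum n d) = c • lp.single 2 w 1 ∧
      (ofLex u).2 ∈ w.head (ofLex u).1 ∧ ∀ a ∈ w.head (ofLex u).1, (ofLex u).2 ≤ a := by
    intro u l c w hl hw
    refine ⟨c * ((moveSign (SignFunction.allNeg (Fin d)) (ofLex u).2
        (w.head (ofLex u).1) : ℤ) : ℂ),
      w.replaceHead (ofLex u).1 (symmDiff (w.head (ofLex u).1) {(ofLex u).2}), ?_, ?_, ?_⟩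
    · have : freeWord (u :: l) = cliffordAction (ofLex u).1 (Clifford.gen (ofLex u).2) *
          freeWord l := by simp [freeWord]
      rw [this, mul_apply_eq_comp, hl, map_smul, cliffordAction_gen_single, smul_smul]
    · rw [ReducedWord.replaceHead, ReducedWord.head_cons, Finset.mem_symmDiff]
      right
      exact ⟨by simp, fun h => lt_irrefl _ (hw _ h)⟩
    · rw [ReducedWord.replaceHead, ReducedWord.head_cons]
      intro a ha
      rw [Finset.mem_symmDiff] at ha
      rcases ha with ha | ha
      · exact (hw a ha.1).le
      · exact (Finset.mem_singleton.mp ha.1).ge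
  induction l generalizing u with
  | nil =>
    refine step u [] 1 ReducedWord.nil ?_ ?_
    · simp [freeWord, vacuum]
    · intro a ha
      simp [ReducedWord.head, ReducedWord.headPart, ReducedWord.nil] at ha
  | cons v l ih =>
    rw [List.isChain_cons_cons] at h
    obtain ⟨c, w, hl, h1, h2⟩ := ih v h.2
    refine step u _ c w hl fun a ha => ?_
    by_cases huv : (ofLex u).1 = (ofLex v).1
    · have hlt := h.1 huv
      rw [Prod.Lex.lt_iff] at hlt
      rcases hlt with hlt | hlt
      · exact absurd huv hlt.ne
      · exact hlt.2.trans_le (h2 a (huv ▸ ha))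
    · rw [ReducedWord.head_eq_empty_of_ne ⟨_, h1⟩ (Ne.symm huv)] at ha
      simp at ha

/-- The copies now are those of the free product. Exchange and cancellation hold inside each copy,
and a nonempty reduced word sends the vacuum to a multiple of an orthogonal basis vector. -/
theorem freeState_ofFn_prod {s : ℕ} (α : Fin s → Fin n) (i : Fin s → Fin d) :
    freeState (List.ofFn fun j => freeGen (α j) (i j)).prod =
      pairingSum (fun u v : Fin n ×ₗ Fin d => if (ofLex u).1 = (ofLex v).1 then -1 else 0)
        Finset.univ (fun j => toLex (α j, i j)) := by
  rw [← eq_pairingSum (copy := fun u : Fin n ×ₗ Fin d => (ofLex u).1)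
    (q := fun u v => if (ofLex u).1 = (ofLex v).1 then -1 else 0)
    ?_ ?_ ?_ ?_ (fun l => inner ℂ (vacuum n d) (freeWord l (vacuum n d))) ?_ ?_ ?_ ?_]
  · rw [Fin.sort_univ, ← List.ofFn_eq_map, freeState, freeWord, SubmonoidClass.coe_list_prod]
    simp only [List.map_ofFn]
    rfl
  · intro u v
    simp only [eq_comm]
  · intro u
    simp
  · intro u v h
    simp [h]
  · intro u v h
    simp [h]
  · simp [freeWord, vacuum, lp.norm_single]
  · intro l₁ l₂ u
    simp only [freeWord, List.map_append, List.map_cons, List.prod_append, List.prod_cons]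
    rw [← mul_assoc (cliffordAction _ _), cliffordAction_gen_mul_self, one_mul]
  · intro l₁ l₂ u v h huv
    have hij : (ofLex u).2 ≠ (ofLex v).2 := fun hc =>
      huv (ofLex.injective (Prod.ext h hc))
    simp only [freeWord, List.map_append, List.map_cons, List.prod_append, List.prod_cons, h,
      if_true]
    rw [← mul_assoc (cliffordAction _ _), cliffordAction_gen_mul_gen _ hij, neg_mul, mul_neg,
      mul_assoc]
    simp
  · intro l hl hch
    obtain ⟨u, l, rfl⟩ := List.exists_cons_of_ne_nil hl
    obtain ⟨c, w, h1, h2, -⟩ := freeWord_vacuum_of_reduced u l hch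
    rw [h1]
    have hne : ReducedWord.nil ≠ w := by
      rintro rfl
      simp [ReducedWord.head, ReducedWord.headPart, ReducedWord.nil] at h2
    rw [inner_smul_right, vacuum, lp.inner_single_left, lp.single_apply_ne _ _ _ hne]
    simp

end FreeMoments

/-! ### Pair partitions as involutions -/

section PairPartitions

variable {s : ℕ}

/-- The pair partition whose blocks are the orbits of an involution. -/
def orbitPartition (f : Equiv.Perm (Fin s)) (hf : ∀ x, f (f x) = x) :
    Finpartition (Finset.univ : Finset (Fin s)) :=
  Finpartition.ofExistsUnique (Finset.univ.image fun x => {x, f x}) (by simp)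
    (by
      intro x _
      refine ⟨{x, f x}, ⟨by simp, by simp⟩, ?_⟩
      rintro V ⟨hV, hx⟩
      simp only [Finset.mem_image, Finset.mem_univ, true_and] at hV
      obtain ⟨y, rfl⟩ := hV
      rcases Finset.mem_insert.mp hx with rfl | hx
      · rfl
      · rw [Finset.mem_singleton.mp hx, hf, Finset.pair_comm])
    (by
      intro h
      simp only [Finset.mem_image, Finset.mem_univ, true_and] at h
      obtain ⟨x, hx⟩ := h
      exact absurd hx (Finset.insert_ne_empty _ _))

theorem mem_orbitPartition {f : Equiv.Perm (Fin s)} {hf : ∀ x, f (f x) = x}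
    {V : Finset (Fin s)} : V ∈ (orbitPartition f hf).parts ↔ ∃ x, {x, f x} = V := by
  change V ∈ Finset.univ.image (fun x => ({x, f x} : Finset (Fin s))) ↔ _
  simp

theorem le_tuplePartition_iff {N : Type*} [DecidableEq N] (t : Fin s → N)
    (σ : Finpartition (Finset.univ : Finset (Fin s))) :
    σ ≤ tuplePartition t ↔ ∀ V ∈ σ.parts, ∀ a ∈ V, ∀ b ∈ V, t a = t b := by
  have hmem : ∀ C, C ∈ (tuplePartition t).parts ↔ ∃ x, C = Finset.univ.filter fun y => t x = t y := by
    intro C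
    simp only [tuplePartition, Finpartition.ofSetoid, Finpartition.ofSetSetoid, Finset.mem_image,
      Finset.mem_univ, true_and, Setoid.ker_def, eq_comm]
  constructor
  · intro h V hV a ha b hb
    obtain ⟨C, hC, hle⟩ := h hV
    obtain ⟨x, rfl⟩ := (hmem C).mp hC
    have h1 := hle ha
    have h2 := hle hb
    simp only [Finset.mem_filter, Finset.mem_univ, true_and] at h1 h2
    rw [← h1, h2]
  · intro h V hV
    obtain ⟨a, ha⟩ := σ.nonempty_of_mem_parts hV
    refine ⟨_, (hmem _).mpr ⟨a, rfl⟩, fun b hb => ?_⟩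
    simpa using h V hV a ha b hb

theorem pair_eq_orbit {f : Equiv.Perm (Fin s)} (hf : ∀ x, f (f x) = x) {e z : Fin s}
    (hez : e ≠ z) (h : ∃ x, {x, f x} = ({e, z} : Finset (Fin s))) : f e = z := by
  obtain ⟨x, hx⟩ := h
  have h1 : e ∈ ({x, f x} : Finset (Fin s)) := hx ▸ by simp
  have h2 : z ∈ ({x, f x} : Finset (Fin s)) := hx ▸ by simp
  have := hf x
  simp only [Finset.mem_insert, Finset.mem_singleton] at h1 h2
  grind

theorem card_crossings_orbitPartition (f : Equiv.Perm (Fin s)) (hf : ∀ x, f (f x) = x) :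
    (crossings (orbitPartition f hf)).card = (chordCrossings f).card := by
  symm
  refine Finset.card_bij (fun z _ => ({z.1, f z.1}, {z.2, f z.2})) ?_ ?_ ?_
  · rintro ⟨e, e'⟩ h
    obtain ⟨h1, h2, h3⟩ := mem_chordCrossings.mp h
    rw [crossings, Finset.mem_filter, Finset.mem_product]
    exact ⟨⟨mem_orbitPartition.mpr ⟨e, rfl⟩, mem_orbitPartition.mpr ⟨e', rfl⟩⟩,
      e, e', f e, f e', h1, h2, h3, rfl, rfl⟩
  · rintro ⟨a, b⟩ h ⟨a', b'⟩ h' heq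
    obtain ⟨h1, h2, h3⟩ := mem_chordCrossings.mp h
    obtain ⟨h1', h2', h3'⟩ := mem_chordCrossings.mp h'
    rw [Prod.mk.injEq] at heq
    have key : ∀ x y : Fin s, x < f x → y < f y → ({x, f x} : Finset (Fin s)) = {y, f y} →
        x = y := by
      intro x y hx hy h
      have h1 : x ∈ ({y, f y} : Finset (Fin s)) := h ▸ by simp
      have := hf y
      simp only [Finset.mem_insert, Finset.mem_singleton] at h1
      grind
    exact Prod.ext (key _ _ (h1.trans h2) (h1'.trans h2') heq.1)
      (key _ _ (h2.trans h3) (h2'.trans h3') heq.2)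
  · rintro ⟨V, V'⟩ h
    rw [crossings, Finset.mem_filter, Finset.mem_product] at h
    obtain ⟨⟨hV, hV'⟩, e, e', z, z', h1, h2, h3, h4, h5⟩ := h
    rw [mem_orbitPartition] at hV hV'
    simp only at h4 h5 hV hV'
    subst h4 h5
    have k1 := pair_eq_orbit hf (h1.trans h2).ne hV
    have k2 := pair_eq_orbit hf (h2.trans h3).ne hV'
    refine ⟨(e, e'), ?_, ?_⟩
    · rw [mem_chordCrossings]
      simp only [k1, k2]
      exact ⟨h1, h2, h3⟩
    · simp only [k1, k2]

theorem mem_mixedCrossings {N : Type*} (α : Fin s → N)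
    (σ : Finpartition (Finset.univ : Finset (Fin s))) (p : Finset (Fin s) × Finset (Fin s)) :
    p ∈ mixedCrossings α σ ↔ p ∈ σ.parts ×ˢ σ.parts ∧ ∃ e e' z z' : Fin s,
      e < e' ∧ e' < z ∧ z < z' ∧ p.1 = {e, z} ∧ p.2 = {e', z'} ∧ α e ≠ α e' := by
  unfold mixedCrossings
  simp only [Finset.mem_filter]

theorem mixedCrossings_orbitPartition {N : Type*} (α : Fin s → N)
    (f : Equiv.Perm (Fin s)) (hf : ∀ x, f (f x) = x) :
    mixedCrossings α (orbitPartition f hf) = ∅ ↔ ∀ z ∈ chordCrossings f, α z.1 = α z.2 := by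
  rw [Finset.eq_empty_iff_forall_notMem]
  constructor
  · rintro h ⟨e, e'⟩ hz
    obtain ⟨h1, h2, h3⟩ := mem_chordCrossings.mp hz
    by_contra hc
    have hp : (({e, f e}, {e', f e'}) : Finset (Fin s) × Finset (Fin s)) ∈
        (orbitPartition f hf).parts ×ˢ (orbitPartition f hf).parts := by
      rw [Finset.mem_product]
      exact ⟨mem_orbitPartition.mpr ⟨e, rfl⟩, mem_orbitPartition.mpr ⟨e', rfl⟩⟩
    refine h ({e, f e}, {e', f e'}) ?_
    rw [mem_mixedCrossings]
    exact ⟨hp, e, e', f e, f e', h1, h2, h3, rfl, rfl, hc⟩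
  · rintro h ⟨V, V'⟩ hp
    rw [mem_mixedCrossings] at hp
    obtain ⟨hp, e, e', z, z', h1, h2, h3, h4, h5, h6⟩ := hp
    obtain ⟨hV, hV'⟩ := Finset.mem_product.mp hp
    rw [mem_orbitPartition] at hV hV'
    simp only at h4 h5 hV hV'
    subst h4 h5
    have k1 := pair_eq_orbit hf (h1.trans h2).ne hV
    have k2 := pair_eq_orbit hf (h2.trans h3).ne hV'
    refine h6 (h (e, e') (mem_chordCrossings.mpr ?_))
    simp only [k1, k2]
    exact ⟨h1, h2, h3⟩

theorem exists_orbitPartition_eq {σ : Finpartition (Finset.univ : Finset (Fin s))}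
    (hσ : IsPairPartition σ) :
    ∃ (f : Equiv.Perm (Fin s)) (hf : ∀ x, f (f x) = x), orbitPartition f hf = σ := by
  have hex : ∀ x, ∃ y, y ≠ x ∧ σ.part x = {x, y} := by
    intro x
    have hx : x ∈ σ.part x := σ.mem_part (Finset.mem_univ x)
    have hc := hσ _ (σ.part_mem.mpr (Finset.mem_univ x))
    obtain ⟨a, b, hab, h⟩ := Finset.card_eq_two.mp hc
    rw [h, Finset.mem_insert, Finset.mem_singleton] at hx
    rcases hx with rfl | rfl
    · exact ⟨b, hab.symm, h⟩
    · exact ⟨a, hab, by rw [h, Finset.pair_comm]⟩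
  choose f hne hf using hex
  -- The partner of `x` lies in the block of `x`, so its own partner, being different from it, is
  -- `x`.
  have hinv : Function.Involutive f := by
    intro x
    have h1 : f x ∈ σ.part x := by rw [hf]; simp
    have h2 : σ.part (f x) = σ.part x :=
      σ.part_eq_of_mem (σ.part_mem.mpr (Finset.mem_univ x)) h1
    have h3 : f (f x) ∈ ({x, f x} : Finset (Fin s)) := by
      rw [← hf x, ← h2, hf (f x)]; simp
    have := hne (f x)
    simp only [Finset.mem_insert, Finset.mem_singleton] at h3
    tauto
  have hinv' : ∀ x, Function.Involutive.toPerm f hinv (Function.Involutive.toPerm f hinv x) = x :=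
    fun x => hinv x
  refine ⟨Function.Involutive.toPerm f hinv, hinv', ?_⟩
  ext V
  rw [mem_orbitPartition]
  constructor
  · rintro ⟨x, rfl⟩
    have := hf x
    simp only [Function.Involutive.coe_toPerm]
    rw [← this]
    exact σ.part_mem.mpr (Finset.mem_univ x)
  · intro hV
    obtain ⟨x, hx⟩ := σ.nonempty_of_mem_parts hV
    exact ⟨x, by rw [← σ.part_eq_of_mem hV hx, hf]; rfl⟩

/-- Sending an involution to its orbits matches pairings with pair partitions. A weight is zero as
soon as one crossing is mixed, and otherwise is -1 to the number of crossings. -/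
theorem sum_admissiblePartitions {n d : ℕ} (α : Fin s → Fin n) (i : Fin s → Fin d) :
    ∑ σ ∈ admissiblePartitions α i, (-1 : ℂ) ^ (crossings σ).card =
      pairingSum (fun u v : Fin n ×ₗ Fin d => if (ofLex u).1 = (ofLex v).1 then -1 else 0)
        Finset.univ (fun j => toLex (α j, i j)) := by
  classical
  set w : Fin s → Fin n ×ₗ Fin d := fun j => toLex (α j, i j) with hw
  set q : Fin n ×ₗ Fin d → Fin n ×ₗ Fin d → ℂ :=
    fun u v => if (ofLex u).1 = (ofLex v).1 then -1 else 0 with hq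
  have h1 : pairingSum q Finset.univ w =
      ∑ f ∈ pairings Finset.univ w with ∀ z ∈ chordCrossings f, α z.1 = α z.2,
        (-1 : ℂ) ^ (chordCrossings f).card := by
    rw [pairingSum, Finset.sum_filter]
    refine Finset.sum_congr rfl fun f _ => ?_
    split_ifs with h
    · rw [crossingWeight, Finset.prod_congr rfl (g := fun _ => (-1 : ℂ)), Finset.prod_const]
      intro z hz
      simp [hq, hw, h z hz]
    · push Not at h
      obtain ⟨z, hz, hne⟩ := h
      refine Finset.prod_eq_zero hz ?_
      simp [hq, hw, hne]
  rw [h1]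
  symm
  have hmem : ∀ f, f ∈ pairings Finset.univ w → ∀ x, f (f x) = x := fun f hf =>
    (mem_pairings.mp hf).1
  have hw' : ∀ x y, w x = w y ↔ α x = α y ∧ i x = i y := by
    intro x y
    simp [hw]
  refine Finset.sum_bij (fun f hf => orbitPartition f (hmem f (Finset.mem_filter.mp hf).1))
    ?_ ?_ ?_ ?_
  · intro f hf
    obtain ⟨hf, hc⟩ := Finset.mem_filter.mp hf
    obtain ⟨h1, h2, h3⟩ := mem_pairings.mp hf
    simp only [hw'] at h3
    rw [admissiblePartitions, Finset.mem_filter]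
    refine ⟨Finset.mem_univ _, ?_, ?_, ?_, (mixedCrossings_orbitPartition α f _).mpr hc⟩
    · intro V hV
      obtain ⟨x, rfl⟩ := mem_orbitPartition.mp hV
      exact Finset.card_pair ((h2 x).mpr (Finset.mem_univ x)).symm
    · rw [le_tuplePartition_iff]
      intro V hV a ha b hb
      obtain ⟨x, rfl⟩ := mem_orbitPartition.mp hV
      have := h3 x
      simp only [Finset.mem_insert, Finset.mem_singleton] at ha hb
      rcases ha with rfl | rfl <;> rcases hb with rfl | rfl <;> simp [this]
    · rw [le_tuplePartition_iff]
      intro V hV a ha b hb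
      obtain ⟨x, rfl⟩ := mem_orbitPartition.mp hV
      have := h3 x
      simp only [Finset.mem_insert, Finset.mem_singleton] at ha hb
      rcases ha with rfl | rfl <;> rcases hb with rfl | rfl <;> simp [this]
  · intro f hf g hg h
    obtain ⟨h1, h2, -⟩ := mem_pairings.mp (Finset.mem_filter.mp hf).1
    obtain ⟨k1, -, -⟩ := mem_pairings.mp (Finset.mem_filter.mp hg).1
    ext1 x
    refine (pair_eq_orbit k1 ((h2 x).mpr (Finset.mem_univ x)).symm ?_).symm
    rw [← mem_orbitPartition (hf := k1), ← h]
    exact mem_orbitPartition.mpr ⟨x, rfl⟩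
  · intro σ hσ
    rw [admissiblePartitions, Finset.mem_filter] at hσ
    obtain ⟨-, hpair, hi, hα, hmix⟩ := hσ
    obtain ⟨f, hf, rfl⟩ := exists_orbitPartition_eq hpair
    rw [le_tuplePartition_iff] at hi hα
    refine ⟨f, ?_, rfl⟩
    rw [Finset.mem_filter]
    refine ⟨mem_pairings.mpr ⟨hf, fun x => ?_, fun x => ?_⟩,
      (mixedCrossings_orbitPartition α f hf).mp hmix⟩
    · simp only [Finset.mem_univ, iff_true]
      intro hx
      have := hpair _ (mem_orbitPartition.mpr ⟨x, rfl⟩)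
      rw [hx] at this
      simp at this
    · rw [hw']
      exact ⟨hα _ (mem_orbitPartition.mpr ⟨x, rfl⟩) _ (by simp) _ (by simp),
        hi _ (mem_orbitPartition.mpr ⟨x, rfl⟩) _ (by simp) _ (by simp)⟩
  · intro f hf
    rw [card_crossings_orbitPartition]

end PairPartitions

/-! ### Random signs -/

section RandomSigns

variable {Ω : Type*} [MeasurableSpace Ω] {μ : Measure Ω}

/-- The sign `ε(u,v)` as a real number. -/
def signVal {I : Type*} (ε : SignFunction I) (u v : I) : ℝ := ((ε.sign u v : ℤ) : ℝ)

theorem signVal_symm {I : Type*} (ε : SignFunction I) (u v : I) :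
    signVal ε u v = signVal ε v u := by
  rw [signVal, signVal, ε.symm]

theorem abs_signVal {I : Type*} (ε : SignFunction I) (u v : I) : |signVal ε u v| = 1 := by
  rcases Int.units_eq_one_or (ε.sign u v) with h | h <;> simp [signVal, h]

theorem abs_prod_signVal {I ι : Type*} (ε : SignFunction I) (J : Finset ι) (p : ι → I × I) :
    |∏ j ∈ J, signVal ε (p j).1 (p j).2| = 1 := by
  rw [Finset.abs_prod, Finset.prod_eq_one]
  intro j _
  exact abs_signVal ..

theorem measurable_units_val_real : Measurable fun x : ℤˣ => ((x : ℤ) : ℝ) :=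
  (measurable_from_top (f := fun z : ℤ => (z : ℝ))).comp (comap_measurable _)

section LinearOrder

variable {I : Type*} [LinearOrder I] {ε : Ω → SignFunction I}

theorem measurable_signVal
    (hmeas : ∀ u v : I, u < v → Measurable fun ω => (ε ω).sign u v) (u v : I) :
    Measurable fun ω => signVal (ε ω) u v := by
  rcases lt_trichotomy u v with h | rfl | h
  · exact measurable_units_val_real.comp (hmeas u v h)
  · simp only [signVal, (ε _).diag]
    exact measurable_const
  · simp only [signVal_symm _ u v]
    exact measurable_units_val_real.comp (hmeas v u h)

theorem integrable_prod_signVal [IsProbabilityMeasure μ]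
    (hmeas : ∀ u v : I, u < v → Measurable fun ω => (ε ω).sign u v) {ι : Type*} (J : Finset ι)
    (p : ι → I × I) : Integrable (fun ω => ∏ j ∈ J, signVal (ε ω) (p j).1 (p j).2) μ := by
  refine Integrable.of_bound (C := 1)
    (Finset.measurable_prod _ fun j _ => measurable_signVal hmeas _ _).aestronglyMeasurable ?_
  refine Filter.Eventually.of_forall fun ω => ?_
  rw [Real.norm_eq_abs, abs_prod_signVal]

omit [LinearOrder I] in
theorem integral_signVal_eq_zero [IsProbabilityMeasure μ] {u v : I}
    (hm : Measurable fun ω => (ε ω).sign u v)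
    (hlaw : μ {ω | (ε ω).sign u v = -1} = 1 / 2) : ∫ ω, signVal (ε ω) u v ∂μ = 0 := by
  have hset : MeasurableSet {ω | (ε ω).sign u v = -1} := by
    have : {ω | (ε ω).sign u v = -1} = {ω | (((ε ω).sign u v : ℤ) : ℝ) = -1} := by
      ext ω
      rcases Int.units_eq_one_or ((ε ω).sign u v) with h | h <;> simp [h]
      norm_num
    rw [this]
    exact (measurable_units_val_real.comp hm) (measurableSet_singleton _)
  have h : (fun ω => signVal (ε ω) u v) =
      fun ω => 1 - 2 * Set.indicator {ω | (ε ω).sign u v = -1} (fun _ => (1 : ℝ)) ω := by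
    ext ω
    rcases Int.units_eq_one_or ((ε ω).sign u v) with h | h
    · rw [Set.indicator_of_notMem (by simp [h])]
      simp [signVal, h]
    · rw [Set.indicator_of_mem (by simpa using h)]
      simp [signVal, h]
      norm_num
  rw [h, integral_sub (integrable_const _)
    (((integrable_const _).indicator hset).const_mul _), integral_const_mul,
    integral_indicator_const _ hset, measureReal_def, hlaw]
  simp

/-- The other factors are functions of signs other than ε(x,y), so the centred sign ε(x,y) is
independent of their product and the integral factors through its mean zero. -/
theorem integral_mul_prod_signVal_eq_zero [IsProbabilityMeasure μ]
    (hmeas : ∀ u v : I, u < v → Measurable fun ω => (ε ω).sign u v)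
    (hindep : iIndepFun
      (fun (p : {p : I × I // p.1 < p.2}) (ω : Ω) => (ε ω).sign p.1.1 p.1.2) μ)
    {x y : I} (hxy : x < y) (hlaw : μ {ω | (ε ω).sign x y = -1} = 1 / 2)
    {ι : Type*} (J : Finset ι) (p : ι → I × I)
    (h1 : ∀ j ∈ J, ¬ ((p j).1 = x ∧ (p j).2 = y)) (h2 : ∀ j ∈ J, ¬ ((p j).1 = y ∧ (p j).2 = x)) :
    ∫ ω, signVal (ε ω) x y * ∏ j ∈ J, signVal (ε ω) (p j).1 (p j).2 ∂μ = 0 := by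
  set m : {p : I × I // p.1 < p.2} → MeasurableSpace Ω := fun r =>
    MeasurableSpace.comap (fun ω => (ε ω).sign r.1.1 r.1.2) inferInstance with hm
  set r₀ : {p : I × I // p.1 < p.2} := ⟨(x, y), hxy⟩ with hr₀
  have hle : ∀ r, m r ≤ ‹MeasurableSpace Ω› := fun r => (hmeas _ _ r.2).comap_le
  -- Independence of the whole family separates the σ-algebra of the sign at `r₀` from that
  -- generated by all other signs. Repetitions among the remaining factors are therefore harmless.
  have hI : Indep (⨆ r ∈ ({r₀} : Set _), m r) (⨆ r ∈ ({r₀}ᶜ : Set _), m r) μ :=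
    indep_iSup_of_disjoint hle hindep.iIndep disjoint_compl_right
  have hcomp : ∀ r : {p : I × I // p.1 < p.2},
      Measurable[m r] fun ω => signVal (ε ω) r.1.1 r.1.2 := fun r =>
    measurable_units_val_real.comp (comap_measurable _)
  have hX : Measurable[⨆ r ∈ ({r₀} : Set _), m r] fun ω => signVal (ε ω) x y :=
    (hcomp r₀).mono (le_iSup₂_of_le r₀ (Set.mem_singleton _) le_rfl) le_rfl
  have hY : Measurable[⨆ r ∈ ({r₀}ᶜ : Set _), m r]
      fun ω => ∏ j ∈ J, signVal (ε ω) (p j).1 (p j).2 := by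
    refine Finset.measurable_prod _ fun j hj => ?_
    rcases lt_trichotomy (p j).1 (p j).2 with h | h | h
    · refine (hcomp ⟨p j, h⟩).mono (le_iSup₂_of_le (⟨p j, h⟩ : {p : I × I // p.1 < p.2}) ?_ le_rfl)
        le_rfl
      intro hc
      have := congrArg Subtype.val (Set.mem_singleton_iff.mp hc)
      exact h1 j hj ⟨congrArg Prod.fst this, congrArg Prod.snd this⟩
    · simp only [h, signVal, (ε _).diag]
      exact measurable_const
    · simp only [signVal_symm _ (p j).1 (p j).2]
      refine (hcomp ⟨((p j).2, (p j).1), h⟩).mono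
        (le_iSup₂_of_le (⟨((p j).2, (p j).1), h⟩ : {p : I × I // p.1 < p.2}) ?_ le_rfl) le_rfl
      intro hc
      have := congrArg Subtype.val (Set.mem_singleton_iff.mp hc)
      exact h2 j hj ⟨congrArg Prod.snd this, congrArg Prod.fst this⟩
  have hXY : IndepFun (fun ω => signVal (ε ω) x y)
      (fun ω => ∏ j ∈ J, signVal (ε ω) (p j).1 (p j).2) μ := by
    rw [IndepFun_iff_Indep]
    exact indep_of_indep_of_le_left (indep_of_indep_of_le_right hI hY.comap_le) hX.comap_le
  rw [hXY.integral_fun_mul_eq_mul_integral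
    (measurable_signVal hmeas _ _).aestronglyMeasurable
    (integrable_prod_signVal hmeas J p).aestronglyMeasurable,
    integral_signVal_eq_zero (hmeas x y hxy) hlaw, zero_mul]

end LinearOrder

/-! ### Almost sure convergence from second moments -/

theorem ae_tendsto_zero_of_integral_sq_le [IsProbabilityMeasure μ] {X : ℕ → Ω → ℝ} (C : ℝ)
    (hint : ∀ m, Integrable (fun ω => X m ω ^ 2) μ)
    (hC : ∀ m, 1 ≤ m → ∫ ω, X m ω ^ 2 ∂μ ≤ C / (m : ℝ) ^ 2) :
    ∀ᵐ ω ∂μ, Tendsto (fun m => X m ω) atTop (𝓝 0) := by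
  -- The index is shifted by one because the bound is assumed only for m ≥ 1. Finite total second
  -- moment makes the sum of the squares finite almost surely, so its terms tend to zero.
  have hsum : ∑' m : ℕ, ENNReal.ofReal (∫ ω, X (m + 1) ω ^ 2 ∂μ) ≠ ∞ := by
    have hs : Summable fun m : ℕ => C / ((m + 1 : ℕ) : ℝ) ^ 2 := by
      have := (Real.summable_one_div_nat_pow (p := 2)).mpr one_lt_two
      have := ((summable_nat_add_iff 1).mpr this).mul_left C
      simpa [div_eq_mul_inv] using this
    refine ne_top_of_le_ne_top hs.tsum_ofReal_ne_top (ENNReal.tsum_le_tsum fun m => ?_)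
    exact ENNReal.ofReal_le_ofReal (hC _ (Nat.le_add_left 1 m))
  have hl : ∀ m, ENNReal.ofReal (∫ ω, X (m + 1) ω ^ 2 ∂μ) =
      ∫⁻ ω, ENNReal.ofReal (X (m + 1) ω ^ 2) ∂μ := fun m =>
    ofReal_integral_eq_lintegral_ofReal (hint _) (Filter.Eventually.of_forall fun ω => sq_nonneg _)
  have hae : ∀ m, AEMeasurable (fun ω => ENNReal.ofReal (X (m + 1) ω ^ 2)) μ := fun m =>
    (hint (m + 1)).aestronglyMeasurable.aemeasurable.ennreal_ofReal
  simp only [hl] at hsum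
  rw [← lintegral_tsum hae] at hsum
  filter_upwards [ae_lt_top' (AEMeasurable.tsum hae) hsum] with ω hω
  have h1 := ENNReal.tendsto_atTop_zero_of_tsum_ne_top hω.ne
  have h2 := (ENNReal.tendsto_toReal ENNReal.zero_ne_top).comp h1
  simp only [Function.comp_def, ENNReal.toReal_ofReal (sq_nonneg _), ENNReal.toReal_zero] at h2
  rw [← tendsto_add_atTop_iff_nat 1, tendsto_zero_iff_abs_tendsto_zero]
  have h3 := (Real.continuous_sqrt.tendsto 0).comp h2
  simpa [Function.comp_def, Real.sqrt_sq_eq_abs] using h3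

end RandomSigns

/-! ### Sums over labelled crossings -/

section CrossSums

/-- Two values of κ are prescribed and the others are free. The count is written as a quotient so
that no truncated exponent |O| - 2 appears. -/
theorem sum_ite_two_values {O : Type*} [Fintype O] [DecidableEq O] {m : ℕ} (hm : m ≠ 0) {a b : O}
    (hab : a ≠ b) (x y : Fin m) :
    ∑ κ : O → Fin m, (if κ a = x ∧ κ b = y then (1 : ℝ) else 0) =
      (m : ℝ) ^ Fintype.card O / (m : ℝ) ^ 2 := by
  have h1 : ∀ κ : O → Fin m, (if κ a = x ∧ κ b = y then (1 : ℝ) else 0) =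
      ∏ o, (if o = a then (if κ o = x then (1 : ℝ) else 0) else 1) *
        (if o = b then (if κ o = y then 1 else 0) else 1) := by
    intro κ
    rw [Finset.prod_mul_distrib, Finset.prod_ite_eq', Finset.prod_ite_eq']
    by_cases h1 : κ a = x <;> by_cases h2 : κ b = y <;> simp [h1, h2]
  simp only [h1]
  rw [← Fintype.prod_sum fun o (k : Fin m) => (if o = a then (if k = x then (1 : ℝ) else 0) else 1) *
        (if o = b then (if k = y then 1 else 0) else 1), eq_div_iff (by positivity)]
  have h2 : (m : ℝ) ^ 2 = ∏ o : O, (if o = a then (m : ℝ) else 1) * (if o = b then (m : ℝ) else 1) := by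
    rw [Finset.prod_mul_distrib, Finset.prod_ite_eq', Finset.prod_ite_eq']
    simp [sq]
  rw [h2, ← Finset.prod_mul_distrib, Fintype.card, ← Finset.prod_const]
  refine Finset.prod_congr rfl fun o _ => ?_
  by_cases ha : o = a
  · subst ha
    simp [hab]
  · by_cases hb : o = b
    · subst hb
      simp [ha]
    · simp [ha, hb]

/-! ### Second moments of products over crossings -/

variable {Ω : Type*} [MeasurableSpace Ω] {μ : Measure Ω} {n d : ℕ} {O : Type*}

/-- The product of the signs over the pairs in `C`, where `o` carries the index `u o (κ o)`. -/
def crossProd (ε : SignFunction (Idx n d)) (C : Finset (O × O)) (u : O → ℕ → Idx n d) {m : ℕ}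
    (κ : O → Fin m) : ℝ :=
  ∏ z ∈ C, signVal ε (u z.1 (κ z.1)) (u z.2 (κ z.2))

theorem abs_crossProd (ε : SignFunction (Idx n d)) (C : Finset (O × O)) (u : O → ℕ → Idx n d)
    {m : ℕ} (κ : O → Fin m) : |crossProd ε C u κ| = 1 :=
  abs_prod_signVal ε C fun z => (u z.1 (κ z.1), u z.2 (κ z.2))

variable [IsProbabilityMeasure μ] {ε : Ω → SignFunction (Idx n d)}

theorem integral_mixed_mul_prod_eq_zero
    (hmeas : ∀ u v : Idx n d, u < v → Measurable fun ω => (ε ω).sign u v)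
    (hindep : iIndepFun
      (fun (p : {p : Idx n d × Idx n d // p.1 < p.2}) (ω : Ω) => (ε ω).sign p.1.1 p.1.2) μ)
    (hlaw : ∀ u v : Idx n d, u < v →
      μ {ω | (ε ω).sign u v = -1} = if u.copy = v.copy then 1 else 1 / 2)
    {x y : Idx n d} (hxy : x.copy ≠ y.copy) {ι : Type*} (J : Finset ι)
    (p : ι → Idx n d × Idx n d)
    (h1 : ∀ j ∈ J, ¬ ((p j).1 = x ∧ (p j).2 = y)) (h2 : ∀ j ∈ J, ¬ ((p j).1 = y ∧ (p j).2 = x)) :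
    ∫ ω, signVal (ε ω) x y * ∏ j ∈ J, signVal (ε ω) (p j).1 (p j).2 ∂μ = 0 := by
  have hne : x ≠ y := fun h => hxy (congrArg Idx.copy h)
  rcases lt_or_gt_of_ne hne with h | h
  · exact integral_mul_prod_signVal_eq_zero hmeas hindep h
      (by rw [hlaw x y h, if_neg hxy]) J p h1 h2
  · simp only [signVal_symm _ x y]
    exact integral_mul_prod_signVal_eq_zero hmeas hindep h
      (by rw [hlaw y x h, if_neg hxy.symm]) J p h2 h1

variable [LinearOrder O]

/-- The fair sign at the crossing `c` occurs exactly once. By `hu` an index determines its label, so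
another occurrence in the product of κ is excluded by injectivity together with `hC`, which rules
out reversed pairs, and an occurrence in the product of κ' is excluded by `h1` and `h2`. The
labelling κ' need not be injective. -/
theorem integral_crossProd_mul_eq_zero
    (hmeas : ∀ u v : Idx n d, u < v → Measurable fun ω => (ε ω).sign u v)
    (hindep : iIndepFun
      (fun (p : {p : Idx n d × Idx n d // p.1 < p.2}) (ω : Ω) => (ε ω).sign p.1.1 p.1.2) μ)
    (hlaw : ∀ u v : Idx n d, u < v →
      μ {ω | (ε ω).sign u v = -1} = if u.copy = v.copy then 1 else 1 / 2)
    {C : Finset (O × O)} (hC : ∀ z ∈ C, z.1 < z.2) {u : O → ℕ → Idx n d}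
    (hu : ∀ o o' k k', u o k = u o' k' → k = k') {c : O × O} (hc : c ∈ C)
    (hmix : ∀ k l, (u c.1 k).copy ≠ (u c.2 l).copy) {m : ℕ} {κ κ' : O → Fin m}
    (hκ : Function.Injective κ)
    (h1 : ∀ z ∈ C, ¬ (κ c.1 = κ' z.1 ∧ κ c.2 = κ' z.2))
    (h2 : ∀ z ∈ C, ¬ (κ c.1 = κ' z.2 ∧ κ c.2 = κ' z.1)) :
    ∫ ω, crossProd (ε ω) C u κ * crossProd (ε ω) C u κ' ∂μ = 0 := by
  have hu' : ∀ (o o' : O) (k k' : Fin m), u o k = u o' k' → k = k' := fun o o' k k' h =>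
    Fin.ext (hu _ _ _ _ h)
  have key : ∀ ω, crossProd (ε ω) C u κ * crossProd (ε ω) C u κ' =
      signVal (ε ω) (u c.1 (κ c.1)) (u c.2 (κ c.2)) *
        ∏ j ∈ (C.erase c).disjSum C, signVal (ε ω)
          (Sum.elim (fun z : O × O => (u z.1 (κ z.1), u z.2 (κ z.2)))
            (fun z => (u z.1 (κ' z.1), u z.2 (κ' z.2))) j).1
          (Sum.elim (fun z : O × O => (u z.1 (κ z.1), u z.2 (κ z.2)))
            (fun z => (u z.1 (κ' z.1), u z.2 (κ' z.2))) j).2 := by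
    intro ω
    rw [Finset.prod_disjSum, ← mul_assoc]
    simp only [Sum.elim_inl, Sum.elim_inr]
    rw [Finset.mul_prod_erase C (fun z => signVal (ε ω) (u z.1 (κ z.1)) (u z.2 (κ z.2))) hc]
    rfl
  simp only [key]
  refine integral_mixed_mul_prod_eq_zero hmeas hindep hlaw (hmix _ _) _ _ ?_ ?_
  · intro j hj
    rw [Finset.mem_disjSum] at hj
    rcases hj with ⟨z, hz, rfl⟩ | ⟨z, hz, rfl⟩
    · rintro ⟨e1, e2⟩
      exact (Finset.mem_erase.mp hz).1
        (Prod.ext (hκ (hu' _ _ _ _ e1)) (hκ (hu' _ _ _ _ e2)))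
    · rintro ⟨e1, e2⟩
      exact h1 z hz ⟨(hu' _ _ _ _ e1).symm, (hu' _ _ _ _ e2).symm⟩
  · intro j hj
    rw [Finset.mem_disjSum] at hj
    rcases hj with ⟨z, hz, rfl⟩ | ⟨z, hz, rfl⟩
    · rintro ⟨e1, e2⟩
      have k1 := hC z (Finset.mem_erase.mp hz).2
      rw [hκ (hu' _ _ _ _ e1), hκ (hu' _ _ _ _ e2)] at k1
      exact lt_asymm k1 (hC c hc)
    · rintro ⟨e1, e2⟩
      exact h2 z hz ⟨(hu' _ _ _ _ e2).symm, (hu' _ _ _ _ e1).symm⟩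

variable [Fintype O]

-- After expanding the square, only the pairs (κ, κ') in which κ' reproduces the two labels of `c`
-- on some crossing, in either order, can contribute, each at most 1. For given κ' and crossing, the
-- two orders leave 2m^|O|/m² choices of κ.
open Classical in
theorem integral_sq_sum_injective_le
    (hmeas : ∀ u v : Idx n d, u < v → Measurable fun ω => (ε ω).sign u v)
    (hindep : iIndepFun
      (fun (p : {p : Idx n d × Idx n d // p.1 < p.2}) (ω : Ω) => (ε ω).sign p.1.1 p.1.2) μ)
    (hlaw : ∀ u v : Idx n d, u < v →
      μ {ω | (ε ω).sign u v = -1} = if u.copy = v.copy then 1 else 1 / 2)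
    {C : Finset (O × O)} (hC : ∀ z ∈ C, z.1 < z.2) {u : O → ℕ → Idx n d}
    (hu : ∀ o o' k k', u o k = u o' k' → k = k') {c : O × O} (hc : c ∈ C)
    (hmix : ∀ k l, (u c.1 k).copy ≠ (u c.2 l).copy) {m : ℕ} (hm : m ≠ 0) :
    ∫ ω, (∑ κ : O → Fin m with Function.Injective κ, crossProd (ε ω) C u κ) ^ 2 ∂μ ≤
      2 * C.card * ((m : ℝ) ^ Fintype.card O) ^ 2 / (m : ℝ) ^ 2 := by
  have hint : ∀ κ κ' : O → Fin m,
      Integrable (fun ω => crossProd (ε ω) C u κ * crossProd (ε ω) C u κ') μ := by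
    intro κ κ'
    refine Integrable.of_bound (C := 1) (Measurable.mul ?_ ?_).aestronglyMeasurable ?_
    · exact Finset.measurable_prod _ fun j _ => measurable_signVal hmeas _ _
    · exact Finset.measurable_prod _ fun j _ => measurable_signVal hmeas _ _
    · refine Filter.Eventually.of_forall fun ω => ?_
      rw [Real.norm_eq_abs, abs_mul, abs_crossProd, abs_crossProd, one_mul]
  have hle1 : ∀ κ κ' : O → Fin m, ∫ ω, crossProd (ε ω) C u κ * crossProd (ε ω) C u κ' ∂μ ≤ 1 := by
    intro κ κ'
    calc _ ≤ ∫ _ω, (1 : ℝ) ∂μ := by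
          refine integral_mono (hint κ κ') (integrable_const _) fun ω => ?_
          refine (le_abs_self _).trans ?_
          rw [abs_mul, abs_crossProd, abs_crossProd, one_mul]
      _ = 1 := by simp
  -- `B` counts the coincidences of labels: it is at least 1 wherever the covariance may fail to
  -- vanish, and it is easy to sum.
  set B : (O → Fin m) → (O → Fin m) → ℝ := fun κ κ' => ∑ z ∈ C,
    ((if κ c.1 = κ' z.1 ∧ κ c.2 = κ' z.2 then (1 : ℝ) else 0) +
      (if κ c.1 = κ' z.2 ∧ κ c.2 = κ' z.1 then 1 else 0)) with hB
  have hterm : ∀ (κ κ' : O → Fin m) (z : O × O), (0 : ℝ) ≤ (if κ c.1 = κ' z.1 ∧ κ c.2 = κ' z.2 then (1 : ℝ) else 0) +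
      (if κ c.1 = κ' z.2 ∧ κ c.2 = κ' z.1 then 1 else 0) := by
    intro κ κ' z
    positivity
  have hB0 : ∀ κ κ', 0 ≤ B κ κ' := fun κ κ' => Finset.sum_nonneg fun z _ => hterm κ κ' z
  have hbound : ∀ κ κ' : O → Fin m, Function.Injective κ →
      ∫ ω, crossProd (ε ω) C u κ * crossProd (ε ω) C u κ' ∂μ ≤ B κ κ' := by
    intro κ κ' hκ
    by_cases h : ∃ z ∈ C, (κ c.1 = κ' z.1 ∧ κ c.2 = κ' z.2) ∨ (κ c.1 = κ' z.2 ∧ κ c.2 = κ' z.1)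
    · obtain ⟨z, hz, h⟩ := h
      refine (hle1 κ κ').trans (le_trans ?_
        (Finset.single_le_sum (fun z _ => hterm κ κ' z) hz))
      rcases h with h | h
      · rw [if_pos h]
        have : (0 : ℝ) ≤ if κ c.1 = κ' z.2 ∧ κ c.2 = κ' z.1 then 1 else 0 := by positivity
        linarith
      · rw [if_pos h]
        have : (0 : ℝ) ≤ if κ c.1 = κ' z.1 ∧ κ c.2 = κ' z.2 then 1 else 0 := by positivity
        linarith
    · push Not at h
      rw [integral_crossProd_mul_eq_zero hmeas hindep hlaw hC hu hc hmix hκ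
        (fun z hz e => (h z hz).1 e.1 e.2) (fun z hz e => (h z hz).2 e.1 e.2)]
      exact hB0 κ κ'
  calc ∫ ω, (∑ κ : O → Fin m with Function.Injective κ, crossProd (ε ω) C u κ) ^ 2 ∂μ
      = ∑ κ : O → Fin m with Function.Injective κ, ∑ κ' : O → Fin m with Function.Injective κ',
          ∫ ω, crossProd (ε ω) C u κ * crossProd (ε ω) C u κ' ∂μ := by
        simp only [sq, Finset.sum_mul_sum]
        rw [integral_finsetSum _ fun κ _ => integrable_finsetSum _ fun κ' _ => hint κ κ']
        refine Finset.sum_congr rfl fun κ _ => ?_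
        rw [integral_finsetSum _ fun κ' _ => hint κ κ']
    _ ≤ ∑ κ : O → Fin m with Function.Injective κ, ∑ κ' : O → Fin m with Function.Injective κ',
          B κ κ' := by
        refine Finset.sum_le_sum fun κ hκ => Finset.sum_le_sum fun κ' _ => ?_
        exact hbound κ κ' (Finset.mem_filter.mp hκ).2
    _ ≤ ∑ κ : O → Fin m, ∑ κ' : O → Fin m, B κ κ' := by
        refine (Finset.sum_le_sum fun κ _ => Finset.sum_le_sum_of_subset_of_nonneg
          (Finset.filter_subset _ _) fun κ' _ _ => hB0 κ κ').trans ?_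
        exact Finset.sum_le_sum_of_subset_of_nonneg (Finset.filter_subset _ _)
          fun κ _ _ => Finset.sum_nonneg fun κ' _ => hB0 κ κ'
    -- With κ' and `z` fixed, each indicator prescribes κ at the two distinct points `c.1` and
    -- `c.2`.
    _ = ∑ κ' : O → Fin m, ∑ z ∈ C, ∑ κ : O → Fin m,
          ((if κ c.1 = κ' z.1 ∧ κ c.2 = κ' z.2 then (1 : ℝ) else 0) +
            (if κ c.1 = κ' z.2 ∧ κ c.2 = κ' z.1 then 1 else 0)) := by
        rw [Finset.sum_comm]
        refine Finset.sum_congr rfl fun κ' _ => ?_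
        rw [Finset.sum_comm]
    _ = 2 * C.card * ((m : ℝ) ^ Fintype.card O) ^ 2 / (m : ℝ) ^ 2 := by
        simp only [Finset.sum_add_distrib, sum_ite_two_values hm (hC c hc).ne, Finset.sum_const,
          Finset.card_univ, Fintype.card_fun, Fintype.card_fin, nsmul_eq_mul]
        push_cast
        ring

-- The sum splits into injective labellings, controlled by the second moment, and the others,
-- controlled by their number since every product has absolute value 1.
open Classical in
theorem ae_tendsto_sum_crossProd_of_mixed
    (hmeas : ∀ u v : Idx n d, u < v → Measurable fun ω => (ε ω).sign u v)
    (hindep : iIndepFun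
      (fun (p : {p : Idx n d × Idx n d // p.1 < p.2}) (ω : Ω) => (ε ω).sign p.1.1 p.1.2) μ)
    (hlaw : ∀ u v : Idx n d, u < v →
      μ {ω | (ε ω).sign u v = -1} = if u.copy = v.copy then 1 else 1 / 2)
    {C : Finset (O × O)} (hC : ∀ z ∈ C, z.1 < z.2) {u : O → ℕ → Idx n d}
    (hu : ∀ o o' k k', u o k = u o' k' → k = k') {c : O × O} (hc : c ∈ C)
    (hmix : ∀ k l, (u c.1 k).copy ≠ (u c.2 l).copy) :
    ∀ᵐ ω ∂μ, Tendsto (fun m : ℕ => (∑ κ : O → Fin m, crossProd (ε ω) C u κ) /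
      (m : ℝ) ^ Fintype.card O) atTop (𝓝 0) := by
  have hinj : ∀ᵐ ω ∂μ, Tendsto (fun m : ℕ =>
      (∑ κ : O → Fin m with Function.Injective κ, crossProd (ε ω) C u κ) /
      (m : ℝ) ^ Fintype.card O) atTop (𝓝 0) := by
    refine ae_tendsto_zero_of_integral_sq_le (2 * C.card) (fun m => ?_) fun m hm => ?_
    -- The bound is the number of labellings over the normalization; leaving the quotient
    -- uncancelled covers m = 0 as well.
    · refine Integrable.of_bound (C := ((m ^ Fintype.card O : ℕ) / (m : ℝ) ^ Fintype.card O) ^ 2)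
        ?_ ?_
      · refine (((Finset.measurable_sum _ fun κ _ => ?_).div_const _).pow_const 2).aestronglyMeasurable
        exact Finset.measurable_prod _ fun j _ => measurable_signVal hmeas _ _
      · refine Filter.Eventually.of_forall fun ω => ?_
        rw [norm_pow, Real.norm_eq_abs, abs_div, abs_of_nonneg (a := (m : ℝ) ^ _) (by positivity)]
        gcongr
        refine (Finset.abs_sum_le_sum_abs _ _).trans ?_
        simp only [abs_crossProd, Finset.sum_const, nsmul_eq_mul, mul_one]
        refine Nat.cast_le.mpr ((Finset.card_le_univ _).trans ?_)
        simp
    · have hm0 : m ≠ 0 := by omega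
      have hm1 : (m : ℝ) ≠ 0 := Nat.cast_ne_zero.mpr hm0
      simp only [div_pow]
      rw [integral_div, div_le_iff₀ (by positivity)]
      refine (integral_sq_sum_injective_le hmeas hindep hlaw hC hu hc hmix hm0).trans (le_of_eq ?_)
      field_simp
  -- This is the proportion of labellings that are not injective: the falling factorial is
  -- asymptotic to the power.
  have hdesc : Tendsto (fun m : ℕ => ((m : ℝ) ^ Fintype.card O - m.descFactorial (Fintype.card O)) /
      (m : ℝ) ^ Fintype.card O) atTop (𝓝 0) := by
    have hz : ∀ᶠ m : ℕ in atTop, ((m : ℝ) ^ Fintype.card O) ≠ 0 :=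
      eventually_atTop.mpr ⟨1, fun m hm => by positivity⟩
    have h1 := (Asymptotics.isEquivalent_iff_tendsto_one hz).mp
      (isEquivalent_descFactorial (Fintype.card O))
    have h2 := h1.const_sub 1
    rw [sub_self] at h2
    refine h2.congr' ?_
    filter_upwards [hz] with m hm
    simp only [Pi.div_apply]
    field_simp
  filter_upwards [hinj] with ω hω
  have hrest : Tendsto (fun m : ℕ =>
      (∑ κ : O → Fin m with ¬ Function.Injective κ, crossProd (ε ω) C u κ) /
      (m : ℝ) ^ Fintype.card O) atTop (𝓝 0) := by
    refine squeeze_zero_norm (fun m => ?_) hdesc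
    rw [Real.norm_eq_abs, abs_div, abs_of_nonneg (a := (m : ℝ) ^ _) (by positivity)]
    gcongr
    refine (Finset.abs_sum_le_sum_abs _ _).trans ?_
    simp only [abs_crossProd, Finset.sum_const, nsmul_eq_mul, mul_one]
    have h1 := Finset.card_filter_add_card_filter_not (s := (Finset.univ : Finset (O → Fin m)))
      (fun κ => Function.Injective κ)
    have h2 : (Finset.univ.filter fun κ : O → Fin m => Function.Injective κ).card =
        m.descFactorial (Fintype.card O) := by
      rw [← Fintype.card_subtype, Fintype.card_congr (Equiv.subtypeInjectiveEquivEmbedding _ _),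
        Fintype.card_embedding_eq, Fintype.card_fin]
    rw [h2, Finset.card_univ, Fintype.card_fun, Fintype.card_fin] at h1
    rw [le_sub_iff_add_le, add_comm]
    exact_mod_cast h1.le
  have := hω.add hrest
  rw [add_zero] at this
  refine this.congr fun m => ?_
  rw [← add_div, Finset.sum_filter_add_sum_filter_not]

end CrossSums

/-! ### The central limit theorem -/

section Limit

variable {n d s : ℕ}

theorem spinTrace_normalizedSum_prod (ε : SignFunction (Idx n d)) (m : ℕ) (i : Fin s → Fin d)
    (α : Fin s → Fin n) :
    spinTrace (truncate ε m) (List.ofFn fun j => normalizedSum ε m (α j) (i j)).prod =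
      (((Real.sqrt m)⁻¹ : ℝ) : ℂ) ^ s * ∑ k : Fin s → Fin m,
        pairingSum (fun u v => (((truncate ε m).sign u v : ℤ) : ℂ)) Finset.univ
          (fun j => mkIdx (α j) (i j) (k j)) := by
  have h : (List.ofFn fun j => normalizedSum ε m (α j) (i j)).prod =
      (((Real.sqrt m)⁻¹ : ℝ) : ℂ) ^ s • ∑ k : Fin s → Fin m,
        (List.ofFn fun j => SpinAlgebra.gen (truncate ε m) (mkIdx (α j) (i j) (k j))).prod := by
    rw [← MultilinearMap.mkPiAlgebraFin_apply (R := ℂ)]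
    unfold normalizedSum
    rw [MultilinearMap.map_smul_univ, MultilinearMap.map_sum]
    simp only [MultilinearMap.mkPiAlgebraFin_apply, Finset.prod_const, Finset.card_univ,
      Fintype.card_fin]
  rw [h, map_smul, map_sum, smul_eq_mul]
  simp only [spinTrace_ofFn_prod]

/-! ### Labels carried by the left endpoints -/

/-- The left endpoints of the chords of `f`. -/
abbrev Openers (f : Equiv.Perm (Fin s)) : Type := {x : Fin s // x < f x}

/-- The crossings as pairs of left endpoints. -/
def openerCrossings (f : Equiv.Perm (Fin s)) : Finset (Openers f × Openers f) :=
  Finset.univ.filter fun z => z.1.1 < z.2.1 ∧ z.2.1 < f z.1.1 ∧ f z.1.1 < f z.2.1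

theorem prod_chordCrossings (f : Equiv.Perm (Fin s)) (g : Fin s × Fin s → ℂ) :
    ∏ z ∈ chordCrossings f, g z = ∏ z ∈ openerCrossings f, g (z.1.1, z.2.1) := by
  symm
  refine Finset.prod_bij (fun z _ => (z.1.1, z.2.1)) ?_ ?_ ?_ ?_
  · intro z hz
    exact mem_chordCrossings.mpr (Finset.mem_filter.mp hz).2
  · rintro ⟨a, b⟩ _ ⟨a', b'⟩ _ h
    rw [Prod.mk.injEq] at h
    exact Prod.ext (Subtype.ext h.1) (Subtype.ext h.2)
  · rintro ⟨a, b⟩ hz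
    have h := mem_chordCrossings.mp hz
    exact ⟨(⟨a, h.1.trans h.2.1⟩, ⟨b, h.2.1.trans h.2.2⟩),
      Finset.mem_filter.mpr ⟨Finset.mem_univ _, h⟩, rfl⟩
  · intros
    rfl

/-- The involution exchanges left and right endpoints. This turns m^(-s/2) into the reciprocal of
the number of labellings. -/
theorem card_openers {f : Equiv.Perm (Fin s)} (h1 : ∀ x, f (f x) = x) (h2 : ∀ x, f x ≠ x) :
    s = 2 * Fintype.card (Openers f) := by
  have h := Fintype.card_subtype_compl (fun x : Fin s => x < f x)
  have e : Fintype.card (Openers f) = Fintype.card {x : Fin s // ¬ x < f x} := by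
    refine Fintype.card_congr (f.subtypeEquiv fun x => ?_)
    rw [h1, not_lt]
    exact ⟨le_of_lt, fun h => lt_of_le_of_ne h (h2 x).symm⟩
  have hle := Fintype.card_subtype_le (fun x : Fin s => x < f x)
  rw [Fintype.card_fin] at h hle
  unfold Openers at e ⊢
  omega

theorem sum_invariant_labels {f : Equiv.Perm (Fin s)} (h1 : ∀ x, f (f x) = x)
    (h2 : ∀ x, f x ≠ x) {m : ℕ} (g : (Openers f → Fin m) → ℂ) :
    ∑ k : Fin s → Fin m with ∀ x, k (f x) = k x, g (fun o => k o) =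
      ∑ κ : Openers f → Fin m, g κ := by
  have hlt : ∀ x, ¬ x < f x → f x < f (f x) := fun x hx => by
    rw [h1]; exact lt_of_le_of_ne (not_lt.mp hx) (h2 x)
  refine Finset.sum_bij' (fun k _ o => k o)
    (fun κ _ x => if h : x < f x then κ ⟨x, h⟩ else κ ⟨f x, hlt x h⟩) ?_ ?_ ?_ ?_ ?_
  · simp
  · intro κ _
    rw [Finset.mem_filter]
    refine ⟨Finset.mem_univ _, fun x => ?_⟩
    dsimp only
    by_cases h : x < f x
    · have h' : ¬ f x < f (f x) := by rw [h1]; exact not_lt.mpr h.le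
      rw [dif_pos h, dif_neg h']
      congr 1
      exact Subtype.ext (h1 x)
    · rw [dif_neg h, dif_pos (hlt x h)]
  · intro k hk
    ext x
    have := (Finset.mem_filter.mp hk).2 x
    by_cases h : x < f x
    · simp [h]
    · simp [h, this]
  · intro κ _
    ext o
    simp [o.2]
  · intros
    rfl

/-- The index carried by the left endpoint `o` with label `k`. -/
def openerIdx (α : Fin s → Fin n) (i : Fin s → Fin d) (f : Equiv.Perm (Fin s)) (o : Openers f)
    (k : ℕ) : Idx n d :=
  toLex (α o, toLex (i o, k))

-- A pairing is compatible with the labelled word exactly when it is compatible with the unlabelled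
-- one and the labels are constant on chords. Exchanging the two sums leaves, for each pairing, a
-- free choice of one label per chord.
open Classical in
theorem sum_pairingSum_labels (ε : SignFunction (Idx n d)) (m : ℕ) (i : Fin s → Fin d)
    (α : Fin s → Fin n) :
    ∑ k : Fin s → Fin m, pairingSum (fun u v => (((truncate ε m).sign u v : ℤ) : ℂ)) Finset.univ
        (fun j => mkIdx (α j) (i j) (k j)) =
      ∑ f ∈ pairings Finset.univ (fun j => (toLex (α j, i j) : Fin n ×ₗ Fin d)),
        ((∑ κ : Openers f → Fin m,
          crossProd ε (openerCrossings f) (openerIdx α i f) κ : ℝ) : ℂ) := by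
  have hp : ∀ k : Fin s → Fin m, pairings Finset.univ (fun j => mkIdx (α j) (i j) (k j)) =
      (pairings Finset.univ (fun j => (toLex (α j, i j) : Fin n ×ₗ Fin d))).filter
        fun f => ∀ x, k (f x) = k x := by
    intro k
    ext f
    rw [Finset.mem_filter, mem_pairings, mem_pairings]
    simp only [mkIdx, EmbeddingLike.apply_eq_iff_eq, Prod.mk.injEq]
    grind
  simp only [pairingSum, hp, Finset.sum_filter]
  rw [Finset.sum_comm]
  refine Finset.sum_congr rfl fun f hf => ?_
  obtain ⟨h1, h2, -⟩ := mem_pairings.mp hf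
  rw [← Finset.sum_filter, Complex.ofReal_sum, ← sum_invariant_labels h1
    (fun x => (h2 x).mpr (Finset.mem_univ x))
    (fun κ => ((crossProd ε (openerCrossings f) (openerIdx α i f) κ : ℝ) : ℂ))]
  refine Finset.sum_congr rfl fun k _ => ?_
  rw [crossingWeight, prod_chordCrossings, crossProd, Complex.ofReal_prod]
  refine Finset.prod_congr rfl fun z _ => ?_
  simp only [signVal, Complex.ofReal_intCast]
  rfl

theorem spinTrace_normalizedSum_prod_eq (ε : SignFunction (Idx n d)) (m : ℕ) (i : Fin s → Fin d)
    (α : Fin s → Fin n) :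
    spinTrace (truncate ε m) (List.ofFn fun j => normalizedSum ε m (α j) (i j)).prod =
      ∑ f ∈ pairings Finset.univ (fun j => (toLex (α j, i j) : Fin n ×ₗ Fin d)),
        (((∑ κ : Openers f → Fin m, crossProd ε (openerCrossings f) (openerIdx α i f) κ) /
          (m : ℝ) ^ Fintype.card (Openers f) : ℝ) : ℂ) := by
  rw [spinTrace_normalizedSum_prod, sum_pairingSum_labels, Finset.mul_sum]
  refine Finset.sum_congr rfl fun f hf => ?_
  obtain ⟨h1, h2, -⟩ := mem_pairings.mp hf
  have hs : ((Real.sqrt m)⁻¹) ^ s = ((m : ℝ) ^ Fintype.card (Openers f))⁻¹ := by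
    conv_lhs => rw [card_openers h1 fun x => (h2 x).mpr (Finset.mem_univ x)]
    rw [pow_mul, inv_pow, Real.sq_sqrt (Nat.cast_nonneg m), inv_pow]
  rw [← Complex.ofReal_pow, hs, ← Complex.ofReal_mul, div_eq_inv_mul]

/-! ### The limit of the average attached to one pairing -/

variable {Ω : Type*} [MeasurableSpace Ω] {μ : Measure Ω} [IsProbabilityMeasure μ]
  {ε : Ω → SignFunction (Idx n d)}

/-- Countability of the index set gives one null set for all pairs at once. -/
theorem ae_sign_eq_neg_one
    (hmeas : ∀ u v : Idx n d, u < v → Measurable fun ω => (ε ω).sign u v)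
    (hlaw : ∀ u v : Idx n d, u < v →
      μ {ω | (ε ω).sign u v = -1} = if u.copy = v.copy then 1 else 1 / 2) :
    ∀ᵐ ω ∂μ, ∀ u v : Idx n d, u.copy = v.copy → signVal (ε ω) u v = -1 := by
  have hlt : ∀ u v : Idx n d, u < v → u.copy = v.copy → ∀ᵐ ω ∂μ, signVal (ε ω) u v = -1 := by
    intro u v huv hc
    have h := hlaw u v huv
    rw [if_pos hc] at h
    have hset : {ω | (ε ω).sign u v = -1} = {ω | signVal (ε ω) u v = -1} := by
      ext ω
      rcases Int.units_eq_one_or ((ε ω).sign u v) with h | h <;> simp [h, signVal]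
      norm_num
    rw [hset] at h
    exact (prob_compl_eq_zero_iff
      (measurable_signVal hmeas u v (measurableSet_singleton (-1)))).mpr h
  have : Countable (Idx n d) := inferInstanceAs (Countable (Fin n × Fin d × ℕ))
  rw [ae_all_iff]
  intro u
  rw [ae_all_iff]
  intro v
  by_cases hc : u.copy = v.copy
  · rcases lt_trichotomy u v with h | rfl | h
    · filter_upwards [hlt u v h hc] with ω hω _ using hω
    · refine Filter.Eventually.of_forall fun ω _ => ?_
      simp [signVal, (ε ω).diag]
    · filter_upwards [hlt v u h hc.symm] with ω hω _
      rw [signVal_symm, hω]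
  · exact Filter.Eventually.of_forall fun ω h => absurd h hc

/-- A mixed crossing makes both the limit of the average and the free weight zero. Without one, the
average is almost surely constant for m ≥ 1 and equal to the free weight. -/
theorem ae_tendsto_sum_crossProd
    (hmeas : ∀ u v : Idx n d, u < v → Measurable fun ω => (ε ω).sign u v)
    (hindep : iIndepFun
      (fun (p : {p : Idx n d × Idx n d // p.1 < p.2}) (ω : Ω) => (ε ω).sign p.1.1 p.1.2) μ)
    (hlaw : ∀ u v : Idx n d, u < v →
      μ {ω | (ε ω).sign u v = -1} = if u.copy = v.copy then 1 else 1 / 2)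
    (i : Fin s → Fin d) (α : Fin s → Fin n) (f : Equiv.Perm (Fin s)) :
    ∀ᵐ ω ∂μ, Tendsto (fun m : ℕ =>
      (((∑ κ : Openers f → Fin m, crossProd (ε ω) (openerCrossings f) (openerIdx α i f) κ) /
          (m : ℝ) ^ Fintype.card (Openers f) : ℝ) : ℂ)) atTop
      (𝓝 (crossingWeight (fun u v : Fin n ×ₗ Fin d => if (ofLex u).1 = (ofLex v).1 then -1 else 0)
        (fun j => toLex (α j, i j)) f)) := by
  rw [crossingWeight, prod_chordCrossings]
  by_cases hmix : ∃ z ∈ openerCrossings f, α z.1.1 ≠ α z.2.1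
  · obtain ⟨c, hc, hne⟩ := hmix
    have hu : ∀ o o' k k', openerIdx α i f o k = openerIdx α i f o' k' → k = k' :=
      fun o o' k k' h => congrArg (fun u : Idx n d => (ofLex (ofLex u).2).2) h
    rw [Finset.prod_eq_zero hc (if_neg hne)]
    filter_upwards [ae_tendsto_sum_crossProd_of_mixed hmeas hindep hlaw
      (C := openerCrossings f) (u := openerIdx α i f) (c := c)
      (fun z hz => (Finset.mem_filter.mp hz).2.1) hu hc (fun _ _ => hne)] with ω hω
    have := (Complex.continuous_ofReal.tendsto 0).comp hω
    rwa [Complex.ofReal_zero] at this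
  · push Not at hmix
    filter_upwards [ae_sign_eq_neg_one hmeas hlaw] with ω hω
    refine tendsto_const_nhds.congr' ?_
    filter_upwards [eventually_ge_atTop 1] with m hm
    have hX : ∀ κ : Openers f → Fin m, crossProd (ε ω) (openerCrossings f) (openerIdx α i f) κ =
        (-1) ^ (openerCrossings f).card := by
      intro κ
      rw [crossProd, Finset.prod_congr rfl (g := fun _ => (-1 : ℝ)), Finset.prod_const]
      exact fun z hz => hω (openerIdx α i f z.1 _) (openerIdx α i f z.2 _) (hmix z hz)
    have hm0 : (m : ℝ) ≠ 0 := by positivity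
    have hq : ∏ z ∈ openerCrossings f, (if α z.1.1 = α z.2.1 then (-1 : ℂ) else 0) =
        (-1) ^ (openerCrossings f).card := by
      rw [Finset.prod_congr rfl fun z hz => if_pos (hmix z hz), Finset.prod_const]
    simp only [hX, Finset.sum_const, Finset.card_univ, Fintype.card_fun, Fintype.card_fin,
      nsmul_eq_mul]
    rw [Nat.cast_pow, mul_div_cancel_left₀ _ (pow_ne_zero _ hm0)]
    push_cast
    exact hq

end Limit

end SpinCLT

end

open SpinCLT

theorem mainTheorem3 {Ω : Type*} [MeasurableSpace Ω] (μ : Measure Ω) [IsProbabilityMeasure μ]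
    (n d : ℕ) (ε : Ω → SignFunction (Idx n d))
    (hmeas : ∀ u v : Idx n d, u < v → Measurable fun ω => (ε ω).sign u v)
    (hindep : iIndepFun
      (fun (p : {p : Idx n d × Idx n d // p.1 < p.2}) (ω : Ω) => (ε ω).sign p.1.1 p.1.2) μ)
    (hlaw : ∀ u v : Idx n d, u < v →
      μ {ω | (ε ω).sign u v = -1} = if u.copy = v.copy then 1 else 1 / 2)
    (s : ℕ) (i : Fin s → Fin d) (α : Fin s → Fin n) :
    (∀ᵐ ω ∂μ, Tendsto
      (fun m : ℕ => spinTrace (truncate (ε ω) m)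
        (List.ofFn fun j : Fin s => normalizedSum (ε ω) m (α j) (i j)).prod)
      atTop
      (𝓝 (freeState (List.ofFn fun j : Fin s => freeGen (α j) (i j)).prod))) ∧
    freeState (List.ofFn fun j : Fin s => freeGen (α j) (i j)).prod =
      ∑ σ ∈ admissiblePartitions α i, (-1 : ℂ) ^ (crossings σ).card := by
  have hstate := freeState_ofFn_prod α i
  refine ⟨?_, hstate.trans (sum_admissiblePartitions α i).symm⟩
  rw [hstate]
  -- There are finitely many permutations, so one null set serves all of them and the limit passes
  -- through the finite sum over pairings.
  have hall : ∀ᵐ ω ∂μ, ∀ f : Equiv.Perm (Fin s), Tendsto (fun m : ℕ =>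
      (((∑ κ : Openers f → Fin m, crossProd (ε ω) (openerCrossings f) (openerIdx α i f) κ) /
          (m : ℝ) ^ Fintype.card (Openers f) : ℝ) : ℂ)) atTop
      (𝓝 (crossingWeight (fun u v : Fin n ×ₗ Fin d => if (ofLex u).1 = (ofLex v).1 then -1 else 0)
        (fun j => toLex (α j, i j)) f)) :=
    ae_all_iff.mpr fun f => ae_tendsto_sum_crossProd hmeas hindep hlaw i α f
  filter_upwards [hall] with ω hω
  simp only [spinTrace_normalizedSum_prod_eq]
  exact tendsto_finsetSum _ fun f _ => hω f
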